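/- Let $\Sigma$ be a non-empty finite linearly ordered alphabet; "smallest" refers to the length-lexicographic order on $\Sigma^*$. Let $L\subseteq\Sigma^\omega$ be accepted by a finite nondeterministic co-Büchi automaton, that is, one with transitions of rank $1$ or $2$ that accepts when some run from an initial state takes only finitely many $1$-transitions. **Relations.** For $u,v\in\Sigma^*$ write $u\sim_L v$ if for all $w\in\Sigma^\omega$: $uw\in L\iff vw\in L$. For pairs of finite words: - $(u,v)\approx_L\bot$ if $v\neq\varepsilon$ and $u(vx)^\omega\notin L$ for all $x$ with $uvx\sim_L u$; put $\mathrm{Sf}(u,v)=\{x : (u,vx)\not\approx_L\bot\}$. - $(u,v)\equiv_L(u',v')$ if $uv\sim_L u'v'$ and $\mathrm{Sf}(u,v)=\mathrm{Sf}(u',v')$; the class of $(u,v)$ is $[u,v]$. - $(u,v)$ is pointed if $(u,v)\not\approx_L\bot$ and $\mathrm{Sf}(u,v)=\mathrm{Sf}(u_1,u_2v)$ for all $u_1,u_2$ with $u_1u_2\sim_L u$ and $(u_1,u_2v)\not\approx_L\bot$. - If $v,v'\ne\varepsilon$, then $(u,v)\approx_L(u',v')$ if $u\sim_L u'$, $uv\sim_L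 u'v'$, and for all $x$ with $uvx\sim_L u$: $u(vx)^\omega\in L\iff u'(v'x)^\omega\in L$. **Canonical automaton.** $\mathcal A_{\equiv_L}$ has as states the classes $[u,v]$ of pointed $(u,v)$, which are initial when $uv\sim_L\varepsilon$; a $2$-transition from $[u,v]$ to $[u,va]$ on $a$ if $(u,va)\not\approx_L\bot$; and a $1$-transition from $[u,v]$ to $[u',v']$ on $a$ if $uva\sim_L u'v'$ (all pairs $(u,v)$, $(u',v')$ pointed). Its safe SCCs are the strongly connected components of its graph of $2$-transitions, and $|\mathcal A_{\equiv_L}|$ is its number of states. **Components.** The component $C(u,v)$ has as states the pairs $(u,vw)\not\approx_L\bot$ such that there is no $w'$ smaller than $w$ with $(u,vw)\approx_L(u,vw')$, and a transition $(u,vw)\to(u,vw')$ on $a$ between two states if $(u,vwa)\approx_L(u,vw')$. For a set $\mathcal C$ of components, $\mathcal A[\mathcal C]$ has as states all states of the components in $\mathcal C$, initial when $uv\sim_L\varepsilon$; the transitions of the components are its $2$-transitions, and it has a $1$-transition $(u,v)\to(u',v')$ on $a$ whenever $uva\sim_L u'v'$. **Algorithm**, with unrestricted access to $L$. Let $R$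 be the set of smallest representatives of the $\sim_L$-classes and $NT=\{u\in R : \exists x\neq\varepsilon,\ ux\sim_L u,\ ux^\omega\in L\}$. Start with $\mathcal C=\{C(u,\varepsilon) : u\in R\setminus NT\}$. While $L\neq L(\mathcal A[\mathcal C])$: 1. find the smallest $u\in R$ such that some $x\ne\varepsilon$ satisfies $ux\sim_L u$ and $ux^\omega\in L\setminus L(\mathcal A[\mathcal C])$, and then the smallest such $x$ for this $u$; 2. let $d$ be the maximum of $1$ and the numbers of states of the components in $\mathcal C$; 3. find any $v$ such that $(u,x^dv)$ is pointed, and add $C(u,x^dv)$ to $\mathcal C$. When the loop is left, return $\mathcal A[\mathcal C]$. **Theorem.** $\mathcal A_{\equiv_L}$ and $R$ are finite. For every choice of the words $v$ in step 3: - the loop is executed at most $|\mathcal A_{\equiv_L}|$ times; - in each iteration all the objects searched for exist, so the algorithm terminates and returns an automaton; - in each iteration, the component $C(u,x^dv)$ that is added is isomorphic, through $(u',v')\mapsto[u',v']$, to the safe SCC of $\mathcal A_{\equiv_L}$ containing $[u,x^dv]$ with its $2$-transitions, and no state of it is $\equiv_L$-equivalent to a state of a component already in $\mathcal C$; - the returned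 automaton is $\mathcal A_{\equiv_L}$ up to the isomorphism $(u',v')\mapsto[u',v']$ (which respects initial states and all transitions with their ranks). -/

import Mathlib

namespace CoBuchiLearning

/-! Infinite words are streams `Stream' α`, finite words are lists. -/

/-- The two transition ranks of a co-Büchi automaton. -/
inductive Rank : Type
  | one
  | two

/-- A (nondeterministic) co-Büchi automaton with state type `Q`. -/
structure CoBuchiAut (α : Type*) (Q : Type*) where
  init : Set Q
  trans : Q → α → Rank → Q → Prop

namespace CoBuchiAut

variable {α : Type*} {Q Q' : Type*}

/-- `r` is the state sequence and `ρ` the rank sequence of a run on `w`. -/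
def IsRun (A : CoBuchiAut α Q) (w : Stream' α) (r : ℕ → Q) (ρ : ℕ → Rank) : Prop :=
  ∀ n, A.trans (r n) (w.get n) (ρ n) (r (n + 1))

/-- The accepted language: some run from an initial state takes only finitely many
1-transitions. -/
def language (A : CoBuchiAut α Q) : Set (Stream' α) :=
  {w | ∃ r ρ, r 0 ∈ A.init ∧ A.IsRun w r ρ ∧ {n | ρ n = Rank.one}.Finite}

/-- One step in the graph of 2-transitions. -/
def SafeEdge (A : CoBuchiAut α Q) (p q : Q) : Prop :=
  ∃ a, A.trans p a Rank.two q

/-- The safe SCC of `q`: its strongly connected component in the graph of 2-transitions. -/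
def safeSCC (A : CoBuchiAut α Q) (q : Q) : Set Q :=
  {p | Relation.ReflTransGen A.SafeEdge q p ∧ Relation.ReflTransGen A.SafeEdge p q}

/-- Isomorphisms of co-Büchi automata. -/
structure Iso (A : CoBuchiAut α Q) (B : CoBuchiAut α Q') extends Q ≃ Q' where
  map_init : ∀ q, toFun q ∈ B.init ↔ q ∈ A.init
  map_trans : ∀ p a i q, B.trans (toFun p) a i (toFun q) ↔ A.trans p a i q

end CoBuchiAut

section Language

variable {α : Type*}

/-- `L` is accepted by a finite co-Büchi automaton. -/
def IsCoBuchi (L : Set (Stream' α)) : Prop :=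
  ∃ (Q : Type) (_ : Finite Q) (A : CoBuchiAut α Q), A.language = L

/-- The right congruence `u ∼_L v`. -/
def Sim (L : Set (Stream' α)) (u v : List α) : Prop :=
  ∀ w : Stream' α, u ++ₛ w ∈ L ↔ v ++ₛ w ∈ L

/-- `u v^ω ∈ L`; false when `v` is empty, as `v^ω` is then not an infinite word. -/
def LassoMem (L : Set (Stream' α)) (u v : List α) : Prop :=
  ∃ h : v ≠ [], u ++ₛ Stream'.cycle v h ∈ L

/-- `(u, v) ≈_L ⊥`. -/
def ApproxBot (L : Set (Stream' α)) (p : List α × List α) : Prop :=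
  p.2 ≠ [] ∧ ∀ x, Sim L (p.1 ++ p.2 ++ x) p.1 → ¬ LassoMem L p.1 (p.2 ++ x)

/-- The set of `x` with `(u, v x) ≉_L ⊥`. -/
def safeExt (L : Set (Stream' α)) (p : List α × List α) : Set (List α) :=
  {x | ¬ ApproxBot L (p.1, p.2 ++ x)}

/-- The equivalence relation `≡_L` on pairs of words. -/
def equivSetoid (L : Set (Stream' α)) : Setoid (List α × List α) where
  r p q := Sim L (p.1 ++ p.2) (q.1 ++ q.2) ∧ safeExt L p = safeExt L q
  iseqv :=
    { refl := fun _ => ⟨fun _ => Iff.rfl, rfl⟩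
      symm := fun h => ⟨fun w => (h.1 w).symm, h.2.symm⟩
      trans := fun h k => ⟨fun w => (h.1 w).trans (k.1 w), h.2.trans k.2⟩ }

/-- The `≡_L`-class of a pair. -/
def cls (L : Set (Stream' α)) (p : List α × List α) : Quotient (equivSetoid L) :=
  Quotient.mk (equivSetoid L) p

/-- Pointed pairs. -/
def Pointed (L : Set (Stream' α)) (p : List α × List α) : Prop :=
  ¬ ApproxBot L p ∧
    ∀ u₁ u₂ : List α, Sim L (u₁ ++ u₂) p.1 → ¬ ApproxBot L (u₁, u₂ ++ p.2) →
      safeExt L p = safeExt L (u₁, u₂ ++ p.2)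

/-- States of the canonical automaton: the `≡_L`-classes containing a pointed pair. -/
def CanState (L : Set (Stream' α)) : Type _ :=
  {c : Quotient (equivSetoid L) // ∃ p, Pointed L p ∧ cls L p = c}

/-- The state given by a pointed pair. -/
def CanState.mk (L : Set (Stream' α)) (p : List α × List α) (hp : Pointed L p) : CanState L :=
  ⟨cls L p, p, hp, rfl⟩

/-- The canonical automaton of `L`. -/
def canonical (L : Set (Stream' α)) : CoBuchiAut α (CanState L) where
  init := {c | ∃ p, Pointed L p ∧ c.1 = cls L p ∧ Sim L (p.1 ++ p.2) []}
  trans c a i c' := match i with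
    | Rank.two => ∃ p, Pointed L p ∧ c.1 = cls L p ∧ ¬ ApproxBot L (p.1, p.2 ++ [a]) ∧
        c'.1 = cls L (p.1, p.2 ++ [a])
    | Rank.one => ∃ p p', Pointed L p ∧ Pointed L p' ∧ c.1 = cls L p ∧ c'.1 = cls L p' ∧
        Sim L (p.1 ++ p.2 ++ [a]) (p'.1 ++ p'.2)

/-- The relation `≈_L`, which is defined on pairs with nonempty second component. -/
def Approx (L : Set (Stream' α)) (p q : List α × List α) : Prop :=
  p.2 ≠ [] ∧ q.2 ≠ [] ∧ Sim L p.1 q.1 ∧ Sim L (p.1 ++ p.2) (q.1 ++ q.2) ∧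
    ∀ x, Sim L (p.1 ++ p.2 ++ x) p.1 → (LassoMem L p.1 (p.2 ++ x) ↔ LassoMem L q.1 (q.2 ++ x))

/-- A component: an automaton with 2-transitions only, whose states are pairs of words. -/
structure Component (α : Type*) where
  states : Set (List α × List α)
  trans : List α × List α → α → List α × List α → Prop

/-- The states of the automaton built from a set of components. -/
def UnionState (𝒞 : Set (Component α)) : Type _ :=
  {p : List α × List α // ∃ C ∈ 𝒞, p ∈ C.states}

/-- The automaton `A[𝒞]` built from a set of components. -/
def autOf (L : Set (Stream' α)) (𝒞 : Set (Component α)) : CoBuchiAut α (UnionState 𝒞) where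
  init := {p | Sim L (p.1.1 ++ p.1.2) []}
  trans p a i q := match i with
    | Rank.two => ∃ C ∈ 𝒞, p.1 ∈ C.states ∧ q.1 ∈ C.states ∧ C.trans p.1 a q.1
    | Rank.one => Sim L (p.1.1 ++ p.1.2 ++ [a]) (q.1.1 ++ q.1.2)

/-- The component `C` is isomorphic, by sending each pair to its `≡_L`-class, to the safe SCC
of the canonical automaton that contains `c`. -/
def IsSafeSCCOf (L : Set (Stream' α)) (C : Component α) (c : CanState L) : Prop :=
  ∃ e : C.states ≃ (canonical L).safeSCC c,
    (∀ p, (e p).1.1 = cls L p.1) ∧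
    ∀ p a q, C.trans p.1 a q.1 ↔ (canonical L).trans (e p).1 a Rank.two (e q).1

end Language

section Algorithm

variable {α : Type*} [LinearOrder α]

/-- `w` is the least element of `S` in the length-lexicographic order. -/
def IsSmallest (S : Set (List α)) (w : List α) : Prop :=
  w ∈ S ∧ ∀ w' ∈ S, w' ≠ w → List.Shortlex (· < ·) w w'

/-- The set of smallest representatives of the classes of `∼_L`. -/
def RSim (L : Set (Stream' α)) : Set (List α) :=
  {u | IsSmallest {u' | Sim L u' u} u}

/-- The representatives `u` of non-trivial classes: `u x ∼_L u` and `u x^ω ∈ L` for some `x`. -/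
def NTSim (L : Set (Stream' α)) : Set (List α) :=
  {u ∈ RSim L | ∃ x, Sim L (u ++ x) u ∧ LassoMem L u x}

/-- The representatives of the extensions `(u, v w) ≉_L ⊥` of `(u, v)` up to `≈_L`: those for which
no smaller `w'` gives `(u, v w') ≈_L (u, v w)`. -/
def RApprox (L : Set (Stream' α)) (p : List α × List α) : Set (List α × List α) :=
  {q | ∃ w, q = (p.1, p.2 ++ w) ∧ ¬ ApproxBot L q ∧
    ∀ w', List.Shortlex (· < ·) w' w → ¬ Approx L q (p.1, p.2 ++ w')}

/-- The component `C(u, v)`. -/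
def comp (L : Set (Stream' α)) (p : List α × List α) : Component α where
  states := RApprox L p
  trans q a q' := q ∈ RApprox L p ∧ q' ∈ RApprox L p ∧ Approx L (q.1, q.2 ++ [a]) q'

/-- The power `x^d`. -/
def wordPow (x : List α) (d : ℕ) : List α := (List.replicate d x).flatten

/-- The set of components with which the learner enters its main loop. -/
def initComponents (L : Set (Stream' α)) : Set (Component α) :=
  {C | ∃ u ∈ RSim L \ NTSim L, C = comp L (u, [])}

/-- One execution of the body of the main loop with current set of components `𝒞`, in which
`u`, `x`, `d` are computed and `(u, x^d v)` is the pointed pair found. -/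
structure IsIteration (L : Set (Stream' α)) (𝒞 : Set (Component α))
    (u x : List α) (d : ℕ) (v : List α) : Prop where
  guard : L ≠ (autOf L 𝒞).language
  u_smallest : IsSmallest
    {u' ∈ RSim L | ∃ x', LassoMem (L \ (autOf L 𝒞).language) u' x' ∧ Sim L (u' ++ x') u'} u
  x_smallest : IsSmallest
    {x' | LassoMem (L \ (autOf L 𝒞).language) u x' ∧ Sim L (u ++ x') u} x
  d_max : IsGreatest ({n : ℕ∞ | ∃ C ∈ 𝒞, n = C.states.encard} ∪ {1}) (d : ℕ∞)
  pointed : Pointed L (u, wordPow x d ++ v)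

/-- `LoopReaches L n 𝒞`: some execution of the learner has set of components `𝒞` after exactly
`n` iterations of its main loop. -/
inductive LoopReaches (L : Set (Stream' α)) : ℕ → Set (Component α) → Prop
  | start : LoopReaches L 0 (initComponents L)
  | iterate {n : ℕ} {𝒞 : Set (Component α)} {u x : List α} {d : ℕ} {v : List α} :
      LoopReaches L n 𝒞 → IsIteration L 𝒞 u x d v →
      LoopReaches L (n + 1) (insert (comp L (u, wordPow x d ++ v)) 𝒞)

/-- The learner can run for exactly `n` iterations of its main loop, leave the loop, and return
the automaton built from the components `𝒞`. -/
def Returns (L : Set (Stream' α)) (n : ℕ) (𝒞 : Set (Component α)) : Prop :=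
  LoopReaches L n 𝒞 ∧ L = (autOf L 𝒞).language

end Algorithm

end CoBuchiLearning

open CoBuchiLearning

namespace CoBuchiLearning

/-! Call a pair live when it is not `≈ ⊥`. The core is `Pointed.lassoMem_iff`: for pointed `(u, v)`
and a non-empty loop `vy` with `uvy ∼ u`, the word `u(vy)^ω` is in `L` exactly when `(u, vyv)` is
live. Pointedness makes each turn of the loop look like the first, so all powers of the loop are
live, and pumping in a finite automaton for `L` turns this into membership. Hence below a pointed
pair with non-empty second word, `≈` and `≡` agree, and every live extension can be continued back
to the starting class. The component of such a pair is therefore a copy of a safe SCC of the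
canonical automaton; `Faithful` records this.

In a union of faithful components, 1-transitions enter any state with the correct `∼`-class. So `u
x^ω` is accepted once all proper prefixes of `u` have states of their class and some state in the
class of `u` can safely read all powers of `x`. This yields disjointness (`IsIteration.cls_ne`): if
a new component met an old one, the old one, with at most `d` states, could read `x^d` from the
class of `u`. By pigeonhole it would have a state of that class reading all powers of `x`, and
minimality of `u` provides states for the prefixes, so the supposed counterexample would be
accepted. Thus the states always inject into the canonical ones, which bounds the iterations.

By Ramsey (`exists_lasso`), a difference of languages shows on a lasso, so a counterexample exists.
When the languages agree, a pointed pair with a non-empty live extension closes up to a lasso in `L`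
whose acceptance forces its class to be present; the remaining classes were there from the start. -/

open Filter

/-! ### Powers of finite words and periodic infinite words. -/

section Streams

variable {α : Type*}

theorem eq_cycle_of_eq_append {x : List α} (hx : x ≠ []) {s : Stream' α} (h : s = x ++ₛ s) :
    s = Stream'.cycle x hx := by
  have hc := Stream'.cycle_eq x hx
  have hl : 0 < x.length := List.length_pos_iff.2 hx
  have key : ∀ n, s.get n = (Stream'.cycle x hx).get n := by
    intro n
    induction n using Nat.strong_induction_on with
    | _ n ih =>
      rw [h, hc]
      by_cases hn : n < x.length
      · rw [Stream'.get_append_left _ _ _ hn, Stream'.get_append_left _ _ _ hn]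
      · obtain ⟨m, rfl⟩ := Nat.exists_eq_add_of_le (not_lt.1 hn)
        rw [Stream'.get_append_right, Stream'.get_append_right]
        exact ih m (by omega)
  exact Stream'.ext key

theorem exists_append_of_append_eq {u v : List α} {s t : Stream' α} (h : u ++ₛ s = v ++ₛ t)
    (hl : u.length ≤ v.length) : ∃ z, v = u ++ z ∧ s = z ++ₛ t := by
  induction u generalizing v with
  | nil => exact ⟨v, rfl, h⟩
  | cons a u ih =>
    cases v with
    | nil => simp at hl
    | cons b v =>
      rw [Stream'.cons_append_stream, Stream'.cons_append_stream] at h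
      obtain ⟨h1, h2⟩ := Stream'.cons_injective2 h
      obtain ⟨z, rfl, hz⟩ := ih h2 (by simpa using hl)
      exact ⟨z, by simp [h1], hz⟩

@[simp] theorem wordPow_zero (x : List α) : wordPow x 0 = [] := rfl

theorem wordPow_succ (x : List α) (n : ℕ) : wordPow x (n + 1) = x ++ wordPow x n := by
  simp [wordPow, List.replicate_succ]

theorem wordPow_add (x : List α) (m n : ℕ) : wordPow x (m + n) = wordPow x m ++ wordPow x n := by
  rw [wordPow, List.replicate_add, List.flatten_append]; rfl

@[simp] theorem wordPow_one (x : List α) : wordPow x 1 = x := by simp [wordPow]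

theorem wordPow_succ' (x : List α) (n : ℕ) : wordPow x (n + 1) = wordPow x n ++ x := by
  rw [wordPow_add, wordPow_one]

theorem length_wordPow (x : List α) (n : ℕ) : (wordPow x n).length = n * x.length := by
  simp [wordPow]

theorem wordPow_ne_nil {x : List α} (hx : x ≠ []) {n : ℕ} (hn : n ≠ 0) : wordPow x n ≠ [] := by
  obtain ⟨m, rfl⟩ := Nat.exists_eq_succ_of_ne_zero hn
  rw [wordPow_succ]
  simp [hx]

theorem le_length_wordPow {x : List α} (hx : x ≠ []) (n : ℕ) : n ≤ (wordPow x n).length := by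
  rw [length_wordPow]
  exact Nat.le_mul_of_pos_right _ (List.length_pos_iff.2 hx)

theorem wordPow_mul (x : List α) (m n : ℕ) : wordPow x (m * n) = wordPow (wordPow x m) n := by
  induction n with
  | zero => rfl
  | succ n ih => rw [Nat.mul_succ, wordPow_add, ih, wordPow_succ']

theorem cycle_eq_wordPow_append {x : List α} (hx : x ≠ []) (n : ℕ) :
    Stream'.cycle x hx = wordPow x n ++ₛ Stream'.cycle x hx := by
  induction n with
  | zero => rfl
  | succ n ih =>
    rw [wordPow_succ, Stream'.append_append_stream, ← ih, ← Stream'.cycle_eq]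

theorem cycle_wordPow {x : List α} (hx : x ≠ []) {n : ℕ} (hn : wordPow x n ≠ []) :
    Stream'.cycle (wordPow x n) hn = Stream'.cycle x hx :=
  (eq_cycle_of_eq_append hn (cycle_eq_wordPow_append hx n)).symm

theorem append_cycle_comm {x y : List α} (h : x ++ y ≠ []) (h' : y ++ x ≠ []) :
    x ++ₛ Stream'.cycle (y ++ x) h' = Stream'.cycle (x ++ y) h := by
  apply eq_cycle_of_eq_append
  conv_lhs => rw [Stream'.cycle_eq]
  simp only [Stream'.append_append_stream]

theorem drop_eq_of_eq_append {u : List α} {w s : Stream' α} (h : w = u ++ₛ s) :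
    w.drop u.length = s := by
  rw [h, Stream'.drop_append_stream]

end Streams

/-! ### Paths, runs and transition profiles. -/

namespace CoBuchiAut

variable {α : Type*} {Q Q' : Type*}

/-- A transition of any rank. -/
def Step (A : CoBuchiAut α Q) (p : Q) (a : α) (q : Q) : Prop := ∃ i, A.trans p a i q

/-- A 2-transition. -/
def SafeStep (A : CoBuchiAut α Q) (p : Q) (a : α) (q : Q) : Prop := A.trans p a Rank.two q

/-- `Paths T w p q`: the word `w` labels a `T`-path from `p` to `q`. -/
def Paths (T : Q → α → Q → Prop) : List α → Q → Q → Prop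
  | [], p, q => p = q
  | a :: w, p, q => ∃ r, T p a r ∧ Paths T w r q

theorem paths_append {T : Q → α → Q → Prop} {u v : List α} {p q : Q} :
    Paths T (u ++ v) p q ↔ ∃ r, Paths T u p r ∧ Paths T v r q := by
  induction u generalizing p with
  | nil => simp [Paths]
  | cons a u ih =>
    simp only [List.cons_append, Paths, ih]
    constructor
    · rintro ⟨r, h, s, h1, h2⟩
      exact ⟨s, ⟨r, h, h1⟩, h2⟩
    · rintro ⟨s, ⟨r, h, h1⟩, h2⟩
      exact ⟨r, h, s, h1, h2⟩

theorem paths_wordPow_self {T : Q → α → Q → Prop} {x : List α} {p : Q} (h : Paths T x p p)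
    (n : ℕ) : Paths T (wordPow x n) p p := by
  induction n with
  | zero => rfl
  | succ n ih =>
    rw [wordPow_succ]
    exact paths_append.2 ⟨p, h, ih⟩

theorem paths_of_forall {w : Stream' α} {r : ℕ → Q} {T : Q → α → Q → Prop}
    {i : ℕ} (hr : ∀ n, i ≤ n → T (r n) (w.get n) (r (n + 1))) {z : List α} {s : Stream' α}
    (h : w.drop i = z ++ₛ s) : Paths T z (r i) (r (i + z.length)) := by
  induction z generalizing i with
  | nil => rfl
  | cons a z ih =>
    rw [Stream'.cons_append_stream] at h
    have h0 : w.get i = a := by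
      have := congrArg (fun t => Stream'.get t 0) h
      simpa [Stream'.get_drop] using this
    have h1 : w.drop (i + 1) = z ++ₛ s := by
      have := congrArg Stream'.tail h
      simpa [Stream'.tail_drop'] using this
    refine ⟨r (i + 1), h0 ▸ hr i le_rfl, ?_⟩
    have := ih (fun n hn => hr n (by omega)) h1
    rwa [show i + 1 + z.length = i + (a :: z).length by simp; omega] at this

/-- An accepting run of `w`, through the paths that it traces on the factors of `w`. -/
theorem exists_run_of_mem {A : CoBuchiAut α Q} {w : Stream' α} (hw : w ∈ A.language) :
    ∃ (r : ℕ → Q) (N : ℕ), r 0 ∈ A.init ∧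
      (∀ u s, w = u ++ₛ s → Paths A.Step u (r 0) (r u.length)) ∧
      ∀ u z s, N ≤ u.length → w = (u ++ z) ++ₛ s →
        Paths A.SafeStep z (r u.length) (r (u ++ z).length) := by
  obtain ⟨r, ρ, h0, hr, hfin⟩ := hw
  obtain ⟨N, hN⟩ := hfin.bddAbove
  refine ⟨r, N + 1, h0, fun u s h => ?_, fun u z s hu h => ?_⟩
  · have := paths_of_forall (i := 0) (T := A.Step) (r := r) (w := w)
      (fun n _ => ⟨_, hr n⟩) (z := u) (s := s) h
    simpa using this
  · rw [List.length_append]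
    rw [Stream'.append_append_stream] at h
    refine paths_of_forall (T := A.SafeStep) (fun n hn => ?_) (drop_eq_of_eq_append h)
    have h2 : ρ n = Rank.two := by
      cases hρ : ρ n with
      | two => rfl
      | one => exact absurd (hN hρ) (by omega)
    have := hr n
    rwa [h2] at this

/-- König's lemma: if every prefix can be read safely from a state, some successor inherits this
property. -/
theorem exists_safe_run [Finite Q] {A : CoBuchiAut α Q} {q : Q} {w : Stream' α}
    (h : ∀ n, ∃ q', Paths A.SafeStep (w.take n) q q') :
    ∃ r : ℕ → Q, r 0 = q ∧ ∀ n, A.SafeStep (r n) (w.get n) (r (n + 1)) := by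
  classical
  let Good : Q → Stream' α → Prop := fun p s => ∀ n, ∃ q', Paths A.SafeStep (s.take n) p q'
  have hnext : ∀ p s, Good p s → ∃ p', A.SafeStep p s.head p' ∧ Good p' s.tail := by
    intro p s hp
    by_contra hcon
    push Not at hcon
    have hbad : ∀ p', ∃ n, A.SafeStep p s.head p' →
        ¬ ∃ q', Paths A.SafeStep (s.tail.take n) p' q' := by
      intro p'
      by_cases hs : A.SafeStep p s.head p'
      · obtain ⟨n, hn⟩ := not_forall.1 (hcon p' hs)
        exact ⟨n, fun _ => hn⟩
      · exact ⟨0, fun h => absurd h hs⟩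
    choose f hf using hbad
    -- If each successor failed at some length, a prefix longer than all these finitely many lengths
    -- could not be read.
    obtain ⟨M, hM⟩ := (Set.finite_range f).bddAbove
    obtain ⟨q', hq'⟩ := hp (M + 1)
    rw [Stream'.take_succ] at hq'
    obtain ⟨p', h1, h2⟩ := hq'
    apply hf p' h1
    obtain ⟨k, hk⟩ := Nat.exists_eq_add_of_le (hM ⟨p', rfl⟩)
    rw [hk, Stream'.take_add] at h2
    obtain ⟨r, hr, _⟩ := paths_append.1 h2
    exact ⟨r, hr⟩
  choose! next hn1 hn2 using hnext
  let r : ℕ → Q := fun n => Nat.rec q (fun n p => next p (w.drop n)) n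
  have hgood : ∀ n, Good (r n) (w.drop n) := by
    intro n
    induction n with
    | zero => exact h
    | succ n ih =>
      have := hn2 _ _ ih
      rwa [Stream'.tail_drop'] at this
  refine ⟨r, rfl, fun n => ?_⟩
  have := hn1 _ _ (hgood n)
  rwa [Stream'.head_drop] at this

theorem mem_language_of_paths [Finite Q] {A : CoBuchiAut α Q} {u : List α} {s : Stream' α}
    {q₀ q : Q} (h0 : q₀ ∈ A.init) (hu : Paths A.Step u q₀ q)
    (hs : ∀ z s', s = z ++ₛ s' → ∃ q', Paths A.SafeStep z q q') : u ++ₛ s ∈ A.language := by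
  suffices H : ∃ (r : ℕ → Q) (ρ : ℕ → Rank), r 0 = q₀ ∧ A.IsRun (u ++ₛ s) r ρ ∧
      {n | ρ n = Rank.one}.Finite by
    obtain ⟨r, ρ, h, h1, h2⟩ := H
    exact ⟨r, ρ, h ▸ h0, h1, h2⟩
  clear h0
  induction u generalizing q₀ with
  | nil =>
    obtain ⟨r, hr, h⟩ := exists_safe_run (A := A) (q := q) (w := s) fun n =>
      hs _ _ (Stream'.append_take_drop n s).symm
    have hq : q₀ = q := hu
    exact ⟨r, fun _ => Rank.two, hr.trans hq.symm, h, by simp⟩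
  | cons a u ih =>
    obtain ⟨q₁, ⟨i, hi⟩, h2⟩ := hu
    obtain ⟨r, ρ, hr0, hr, hfin⟩ := ih h2
    refine ⟨fun n => Nat.casesOn n q₀ r, fun n => Nat.casesOn n i ρ, rfl, ?_, ?_⟩
    · intro n
      cases n with
      | zero =>
        subst hr0
        exact hi
      | succ n => exact hr n
    · refine ((Set.finite_singleton 0).union (hfin.image Nat.succ)).subset ?_
      intro n hn
      cases n with
      | zero => simp
      | succ n => exact Or.inr ⟨n, hn, rfl⟩

/-- The pair of transition relations of a word. -/
def profile (A : CoBuchiAut α Q) (w : List α) : (Q → Q → Prop) × (Q → Q → Prop) :=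
  (Paths A.Step w, Paths A.SafeStep w)

theorem profile_append {A : CoBuchiAut α Q} {u u' v v' : List α}
    (hu : A.profile u = A.profile u') (hv : A.profile v = A.profile v') :
    A.profile (u ++ v) = A.profile (u' ++ v') := by
  simp only [profile, Prod.mk.injEq] at *
  constructor <;> ext p q <;> simp only [paths_append, hu, hv]

theorem profile_wordPow {A : CoBuchiAut α Q} {x x' : List α} (h : A.profile x = A.profile x')
    (n : ℕ) : A.profile (wordPow x n) = A.profile (wordPow x' n) := by
  induction n with
  | zero => rfl
  | succ n ih =>
    rw [wordPow_succ, wordPow_succ]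
    exact profile_append h ih

theorem paths_step_iff_of_profile {A : CoBuchiAut α Q} {u v : List α}
    (h : A.profile u = A.profile v) {p q : Q} : Paths A.Step u p q ↔ Paths A.Step v p q := by
  have := congrArg Prod.fst h
  exact iff_of_eq (congrFun (congrFun this p) q)

theorem paths_safeStep_iff_of_profile {A : CoBuchiAut α Q} {u v : List α}
    (h : A.profile u = A.profile v) {p q : Q} :
    Paths A.SafeStep u p q ↔ Paths A.SafeStep v p q := by
  have := congrArg Prod.snd h
  exact iff_of_eq (congrFun (congrFun this p) q)

/-- An accepting run is cut `N` letters after `u`, beyond its last 1-transition; the part before the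
cut is replaced by a path with the same end points. -/
theorem append_mem_language_iff_of_profile [Finite Q] {A : CoBuchiAut α Q} {u v : List α}
    (h : A.profile u = A.profile v) (s : Stream' α) :
    u ++ₛ s ∈ A.language ↔ v ++ₛ s ∈ A.language := by
  have key : ∀ {u v : List α}, A.profile u = A.profile v → u ++ₛ s ∈ A.language →
      v ++ₛ s ∈ A.language := by
    intro u v h hu
    obtain ⟨r, N, h0, h1, h2⟩ := exists_run_of_mem hu
    have hs := Stream'.append_take_drop N s
    have e : u ++ₛ s = (u ++ s.take N) ++ₛ s.drop N := by
      rw [Stream'.append_append_stream, hs]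
    have e' : v ++ₛ s = (v ++ s.take N) ++ₛ s.drop N := by
      rw [Stream'.append_append_stream, hs]
    rw [e']
    refine mem_language_of_paths h0
      ((paths_step_iff_of_profile (profile_append h rfl)).1 (h1 _ _ e)) fun z s' hz => ?_
    refine ⟨_, h2 (u ++ s.take N) z s' (by simp) ?_⟩
    rw [e, hz, ← Stream'.append_append_stream]
  exact ⟨key h, key h.symm⟩

end CoBuchiAut

open CoBuchiAut

/-! ### Ramsey's theorem and reduction to ultimately periodic words. -/

section Lasso

variable {α : Type*} {Q Q' : Type*}

/-- After enough copies of `x` an accepting run is past its last 1-transition; the converse is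
König's lemma. -/
theorem lassoMem_language_iff [Finite Q] {A : CoBuchiAut α Q} {u x : List α} :
    LassoMem A.language u x ↔ x ≠ [] ∧ ∃ m, ∃ q₀ ∈ A.init, ∃ q,
      Paths A.Step (u ++ wordPow x m) q₀ q ∧ ∀ n, ∃ q', Paths A.SafeStep (wordPow x n) q q' := by
  constructor
  · rintro ⟨hx, h⟩
    obtain ⟨r, N, h0, h1, h2⟩ := exists_run_of_mem h
    have e : ∀ n, u ++ₛ Stream'.cycle x hx = (u ++ wordPow x n) ++ₛ Stream'.cycle x hx := by
      intro n
      rw [Stream'.append_append_stream, ← cycle_eq_wordPow_append]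
    refine ⟨hx, N, r 0, h0, _, h1 _ _ (e N), fun n => ⟨_, h2 _ (wordPow x n)
      (Stream'.cycle x hx) ?_ ?_⟩⟩
    · have := le_length_wordPow hx N
      simp only [List.length_append]
      omega
    · rw [List.append_assoc, ← wordPow_add, ← e]
  · rintro ⟨hx, m, q₀, h0, q, hq, hs⟩
    refine ⟨hx, ?_⟩
    rw [cycle_eq_wordPow_append hx m, ← Stream'.append_append_stream]
    refine mem_language_of_paths h0 hq fun z s' hz => ?_
    obtain ⟨q', hq'⟩ := hs z.length
    rw [cycle_eq_wordPow_append hx z.length] at hz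
    obtain ⟨y, hy, -⟩ := exists_append_of_append_eq hz.symm (le_length_wordPow hx _)
    rw [hy] at hq'
    obtain ⟨q'', h, -⟩ := paths_append.1 hq'
    exact ⟨q'', h⟩

theorem LassoMem.of_profile [Finite Q] {A : CoBuchiAut α Q} {u v x y : List α}
    (hu : A.profile u = A.profile v) (hx : A.profile x = A.profile y) (hy : y ≠ [])
    (h : LassoMem A.language u x) : LassoMem A.language v y := by
  rw [lassoMem_language_iff] at h ⊢
  obtain ⟨-, m, q₀, h0, q, hq, hs⟩ := h
  refine ⟨hy, m, q₀, h0, q,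
    (paths_step_iff_of_profile (profile_append hu (profile_wordPow hx m))).1 hq, fun n => ?_⟩
  obtain ⟨q', hq'⟩ := hs n
  exact ⟨q', (paths_safeStep_iff_of_profile (profile_wordPow hx n)).1 hq'⟩

/-- Ramsey's theorem for pairs of natural numbers. -/
theorem exists_monochromatic_seq {F : Type*} [Finite F] (col : ℕ → ℕ → F) :
    ∃ (k : ℕ → ℕ) (e : F), ∀ i j, i < j → k i < k j ∧ col (k i) (k j) = e := by
  classical
  have lim : ∀ g : ℕ → F, ∃ c, ∀ᶠ j in (hyperfilter ℕ : Filter ℕ), g j = c := by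
    intro g
    have h : ∀ᶠ j in (hyperfilter ℕ : Filter ℕ), ∃ c ∈ (Set.univ : Set F), g j = c :=
      Eventually.of_forall fun j => ⟨g j, trivial, rfl⟩
    obtain ⟨c, -, hc⟩ := (Ultrafilter.eventually_exists_mem_iff Set.finite_univ).1 h
    exact ⟨c, hc⟩
  -- `c i` is the limit colour of row `i` along a non-principal ultrafilter and `e` is the limit of
  -- `c`. Each new index is taken from a finite intersection of large sets.
  choose c hc using fun i => lim (col i)
  obtain ⟨e, he⟩ := lim c
  obtain ⟨k, -, hk⟩ := exists_seq_of_forall_finset_exists (fun i => c i = e)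
    (fun i j => i < j ∧ col i j = e) fun s hs => by
      have h1 : ∀ᶠ j in (hyperfilter ℕ : Filter ℕ), ∀ i ∈ s, i < j ∧ col i j = e := by
        refine (eventually_all_finset s).2 fun i hi => ?_
        have hgt : ∀ᶠ j in (hyperfilter ℕ : Filter ℕ), i < j :=
          (Nat.hyperfilter_le_atTop : (hyperfilter ℕ : Filter ℕ) ≤ atTop) (eventually_gt_atTop i)
        filter_upwards [hgt, hc i] with j hj hcj
        exact ⟨hj, hcj.trans (hs i hi)⟩
      exact (he.and h1).exists
  exact ⟨k, e, hk⟩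

theorem take_append_segment (w : Stream' α) {i j : ℕ} (h : i ≤ j) :
    w.take i ++ (w.drop i).take (j - i) = w.take j := by
  rw [← Stream'.take_add, Nat.add_sub_cancel' h]

theorem segment_append_segment (w : Stream' α) {i j l : ℕ} (h : i ≤ j) (h' : j ≤ l) :
    (w.drop i).take (j - i) ++ (w.drop j).take (l - j) = (w.drop i).take (l - i) := by
  have := take_append_segment (w.drop i) (i := j - i) (j := l - i) (by omega)
  rwa [Stream'.drop_drop, show i + (j - i) = j by omega, show l - i - (j - i) = l - j by omega]
    at this

/-- The common profile `e` is idempotent, since adjacent segments join to a segment. The prefix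
stops at `k 1`, not `k 0`, so that it already ends in a segment of profile `e` and absorbs further
ones. -/
theorem mem_language_iff_lassoMem_of_profile [Finite Q] {A : CoBuchiAut α Q} {w : Stream' α}
    {k : ℕ → ℕ} {e : (Q → Q → Prop) × (Q → Q → Prop)}
    (hk : ∀ i j, i < j → k i < k j ∧ A.profile ((w.drop (k i)).take (k j - k i)) = e) :
    A.profile (w.take (k 1) ++ (w.drop (k 1)).take (k 2 - k 1)) = A.profile (w.take (k 1)) ∧
    (w ∈ A.language ↔ LassoMem A.language (w.take (k 1)) ((w.drop (k 1)).take (k 2 - k 1))) := by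
  have hmono : StrictMono k := fun i j h => (hk i j h).1
  set x := (w.drop (k 1)).take (k 2 - k 1) with hx
  have hx0 : x ≠ [] := by
    have h : x.length = k 2 - k 1 := Stream'.length_take ..
    have := hmono (show 1 < 2 by omega)
    intro h'
    rw [h', List.length_nil] at h
    omega
  have hxe : A.profile x = e := (hk 1 2 (by omega)).2
  have hpow : ∀ n, A.profile (wordPow x (n + 1)) = e := by
    intro n
    induction n with
    | zero => simpa using hxe
    | succ n ih =>
      rw [wordPow_succ]
      rw [profile_append (u' := (w.drop (k 1)).take (k 2 - k 1))
        (v' := (w.drop (k 2)).take (k 3 - k 2)) rfl (ih.trans (hk 2 3 (by omega)).2.symm),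
        segment_append_segment w (hmono (by omega)).le (hmono (by omega)).le]
      exact (hk 1 3 (by omega)).2
  have htake : ∀ i, A.profile (w.take (k (i + 1))) = A.profile (w.take (k 1)) := by
    intro i
    rw [← take_append_segment w (hmono (Nat.succ_pos i)).le,
      ← take_append_segment w (hmono (Nat.one_pos)).le]
    exact profile_append rfl ((hk _ _ (by omega)).2.trans (hk _ _ (by omega)).2.symm)
  have hux : A.profile (w.take (k 1) ++ x) = A.profile (w.take (k 1)) := by
    rw [hx, take_append_segment w (hmono (by omega)).le, htake 1]
  refine ⟨hux, fun hw => ?_, fun h => ?_⟩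
  · obtain ⟨r, N, h0, h1, h2⟩ := exists_run_of_mem hw
    refine lassoMem_language_iff.2 ⟨hx0, 0, r 0, h0, r (k (N + 1)), ?_, fun n => ?_⟩
    · have := h1 _ _ (Stream'.append_take_drop (k (N + 1)) w).symm
      rw [Stream'.length_take] at this
      rw [wordPow_zero, List.append_nil]
      exact (paths_step_iff_of_profile (htake N)).1 this
    · cases n with
      | zero => exact ⟨_, rfl⟩
      | succ n =>
        have hN : N ≤ k (N + 1) := (Nat.le_succ N).trans hmono.le_apply
        have := h2 (w.take (k (N + 1))) ((w.drop (k (N + 1))).take (k (N + 2) - k (N + 1)))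
          (w.drop (k (N + 2))) (by simpa using hN)
          (by rw [take_append_segment w (hmono (by omega)).le, Stream'.append_take_drop])
        rw [Stream'.length_take] at this
        exact ⟨_, (paths_safeStep_iff_of_profile
          ((hk (N + 1) (N + 2) (by omega)).2.trans (hpow n).symm)).1 this⟩
  · obtain ⟨-, m, q₀, h0, q, hq, hs⟩ := lassoMem_language_iff.1 h
    rw [← Stream'.append_take_drop (k 1) w]
    have hm : A.profile (w.take (k 1) ++ wordPow x m) = A.profile (w.take (k 1)) := by
      cases m with
      | zero => simp
      | succ m =>
        rw [← hux]
        exact profile_append rfl ((hpow m).trans hxe.symm)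
    refine mem_language_of_paths h0 ((paths_step_iff_of_profile hm).1 hq) fun z s hz => ?_
    obtain ⟨q', hq'⟩ := hs 1
    have hk2 : 1 < z.length + 2 := by omega
    rw [paths_safeStep_iff_of_profile ((hpow 0).trans (hk 1 (z.length + 2) hk2).2.symm)] at hq'
    have hlen : z.length ≤ k (z.length + 2) - k 1 := by
      have h3 : z.length + 1 + k 1 ≤ k (z.length + 2) := hmono.add_le_nat (z.length + 1) 1
      omega
    rw [← Stream'.append_take_drop (k (z.length + 2) - k 1) (w.drop (k 1))] at hz
    obtain ⟨y, hy, -⟩ := exists_append_of_append_eq hz.symm (by simpa using hlen)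
    rw [hy] at hq'
    obtain ⟨q'', h, -⟩ := paths_append.1 hq'
    exact ⟨q'', h⟩

/-- Every infinite word can be replaced by an ultimately periodic one, without a change of its
membership in two given co-Büchi languages. -/
theorem exists_lasso [Finite Q] [Finite Q'] (A : CoBuchiAut α Q) (B : CoBuchiAut α Q')
    (w : Stream' α) : ∃ u x, A.profile (u ++ x) = A.profile u ∧
      (w ∈ A.language ↔ LassoMem A.language u x) ∧ (w ∈ B.language ↔ LassoMem B.language u x) := by
  obtain ⟨k, e, hk⟩ := exists_monochromatic_seq fun i j =>
    (A.profile ((w.drop i).take (j - i)), B.profile ((w.drop i).take (j - i)))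
  have hA := mem_language_iff_lassoMem_of_profile (A := A) (e := e.1) fun i j h =>
    ⟨(hk i j h).1, congrArg Prod.fst (hk i j h).2⟩
  have hB := mem_language_iff_lassoMem_of_profile (A := B) (e := e.2) fun i j h =>
    ⟨(hk i j h).1, congrArg Prod.snd (hk i j h).2⟩
  exact ⟨_, _, hA.1, hA.2, hB.2⟩

end Lasso

/-! ### The right congruence and live pairs. -/

section Congruence

variable {α : Type*} {L : Set (Stream' α)}

theorem Sim.refl (u : List α) : Sim L u u := fun _ => Iff.rfl

theorem Sim.symm {u v : List α} (h : Sim L u v) : Sim L v u := fun w => (h w).symm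

theorem Sim.trans {u v w : List α} (h : Sim L u v) (h' : Sim L v w) : Sim L u w :=
  fun s => (h s).trans (h' s)

theorem Sim.append {u v : List α} (h : Sim L u v) (w : List α) : Sim L (u ++ w) (v ++ w) := by
  intro s
  rw [Stream'.append_append_stream, Stream'.append_append_stream]
  exact h _

theorem Sim.wordPow {u x : List α} (h : Sim L (u ++ x) u) (n : ℕ) :
    Sim L (u ++ wordPow x n) u := by
  induction n with
  | zero => simpa using Sim.refl u
  | succ n ih =>
    rw [wordPow_succ, ← List.append_assoc]
    exact (h.append _).trans ih

theorem Sim.lassoMem_iff {u v : List α} (h : Sim L u v) {x : List α} :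
    LassoMem L u x ↔ LassoMem L v x :=
  exists_congr fun _ => h _

theorem LassoMem.ne_nil {u x : List α} (h : LassoMem L u x) : x ≠ [] := h.1

theorem lassoMem_wordPow_iff {u x : List α} {n : ℕ} (hn : n ≠ 0) :
    LassoMem L u (wordPow x n) ↔ LassoMem L u x := by
  constructor
  · rintro ⟨h, h'⟩
    have hx : x ≠ [] := by
      rintro rfl
      exact h (by simp [CoBuchiLearning.wordPow])
    exact ⟨hx, cycle_wordPow hx h ▸ h'⟩
  · rintro ⟨h, h'⟩
    exact ⟨wordPow_ne_nil h hn, (cycle_wordPow h (wordPow_ne_nil h hn)).symm ▸ h'⟩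

theorem lassoMem_rotate_iff {u x y : List α} :
    LassoMem L u (x ++ y) ↔ LassoMem L (u ++ x) (y ++ x) := by
  have hne : x ++ y ≠ [] ↔ y ++ x ≠ [] := by simp [and_comm]
  constructor
  · rintro ⟨h, h'⟩
    refine ⟨hne.1 h, ?_⟩
    rwa [Stream'.append_append_stream, append_cycle_comm h (hne.1 h)]
  · rintro ⟨h, h'⟩
    refine ⟨hne.2 h, ?_⟩
    rwa [Stream'.append_append_stream, append_cycle_comm (hne.2 h) h] at h'

theorem lassoMem_diff_iff {M : Set (Stream' α)} {u x : List α} :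
    LassoMem (L \ M) u x ↔ LassoMem L u x ∧ ¬ LassoMem M u x := by
  constructor
  · rintro ⟨h, h1, h2⟩
    exact ⟨⟨h, h1⟩, fun h' => h2 h'.2⟩
  · rintro ⟨⟨h, h1⟩, h2⟩
    exact ⟨h, h1, fun h' => h2 ⟨h, h'⟩⟩

/-- `(u, v)` is not equivalent to `⊥`. -/
abbrev Live (L : Set (Stream' α)) (u v : List α) : Prop := ¬ ApproxBot L (u, v)

theorem live_iff {u v : List α} :
    Live L u v ↔ v = [] ∨ ∃ x, Sim L (u ++ v ++ x) u ∧ LassoMem L u (v ++ x) := by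
  simp only [Live, ApproxBot]
  push Not
  rw [← or_iff_not_imp_left]

theorem live_nil (u : List α) : Live L u [] := live_iff.2 (Or.inl rfl)

theorem Live.of_append {u v x : List α} (h : Live L u (v ++ x)) : Live L u v := by
  rw [live_iff] at *
  rcases h with h | ⟨y, h1, h2⟩
  · exact Or.inl (List.append_eq_nil_iff.1 h).1
  · exact Or.inr ⟨x ++ y, by simpa using h1, by simpa using h2⟩

/-- Rotate the loop: `u₁(u₂vy)^ω = u₁u₂(vyu₂)^ω`. -/
theorem Live.of_left {u₁ u₂ v : List α} (h : Live L u₁ (u₂ ++ v)) : Live L (u₁ ++ u₂) v := by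
  rw [live_iff] at *
  rcases h with h | ⟨y, h1, h2⟩
  · exact Or.inl (List.append_eq_nil_iff.1 h).2
  · refine Or.inr ⟨y ++ u₂, ?_, ?_⟩
    · simpa using h1.append u₂
    · rw [List.append_assoc, lassoMem_rotate_iff] at h2
      simpa using h2

theorem Live.congr {u u' v : List α} (h : Sim L u u') (hl : Live L u v) : Live L u' v := by
  rw [live_iff] at *
  rcases hl with hl | ⟨y, h1, h2⟩
  · exact Or.inl hl
  · refine Or.inr ⟨y, ?_, h.lassoMem_iff.1 h2⟩
    have := ((h.symm.append (v ++ y)).trans (by simpa using h1)).trans h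
    simpa using this

theorem live_wordPow {u x : List α} (h : Sim L (u ++ x) u) (hx : LassoMem L u x) (n : ℕ) :
    Live L u (wordPow x n) := by
  rw [live_iff]
  cases n with
  | zero => exact Or.inl rfl
  | succ n =>
    exact Or.inr ⟨[], by simpa using h.wordPow (n + 1),
      by simpa using (lassoMem_wordPow_iff (Nat.succ_ne_zero n)).2 hx⟩

theorem Live.exists_return {u v : List α} (h : Live L u v) :
    ∃ y, Sim L (u ++ (v ++ y)) u ∧ ∀ n, Live L u (wordPow (v ++ y) n) := by
  rcases live_iff.1 h with rfl | ⟨y, h1, h2⟩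
  · refine ⟨[], by simpa using Sim.refl u, fun n => ?_⟩
    have : wordPow ([] ++ []) n = ([] : List α) := by simp [wordPow]
    rw [this]
    exact live_nil u
  · rw [List.append_assoc] at h1
    exact ⟨y, h1, live_wordPow h1 h2⟩

/-- Moving letters into the second word can only shrink the set of safe extensions; pointed pairs
are those where it can shrink no further. -/
theorem safeExt_subset_left (u₁ u₂ v : List α) :
    safeExt L (u₁, u₂ ++ v) ⊆ safeExt L (u₁ ++ u₂, v) := fun x (h : Live L u₁ _) =>
  Live.of_left (by simpa using h)

theorem safeExt_congr {u u' : List α} (h : Sim L u u') (v : List α) :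
    safeExt L (u, v) = safeExt L (u', v) :=
  Set.ext fun _ => ⟨fun hx => Live.congr h hx, fun hx => Live.congr h.symm hx⟩

theorem cls_eq_iff {u v u' v' : List α} : cls L (u, v) = cls L (u', v') ↔
    Sim L (u ++ v) (u' ++ v') ∧ safeExt L (u, v) = safeExt L (u', v') :=
  Quotient.eq (r := equivSetoid L)

theorem live_append_iff_of_safeExt_eq {u v u' v' : List α}
    (h : safeExt L (u, v) = safeExt L (u', v')) (w : List α) :
    Live L u (v ++ w) ↔ Live L u' (v' ++ w) :=
  iff_of_eq (congrFun h w)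

theorem safeExt_append {u v u' v' : List α} (h : safeExt L (u, v) = safeExt L (u', v'))
    (w : List α) : safeExt L (u, v ++ w) = safeExt L (u', v' ++ w) := by
  ext x
  have := live_append_iff_of_safeExt_eq h (w ++ x)
  simpa [safeExt] using this

theorem cls_append {u v u' v' : List α} (h : cls L (u, v) = cls L (u', v')) (w : List α) :
    cls L (u, v ++ w) = cls L (u', v' ++ w) := by
  rw [cls_eq_iff] at *
  exact ⟨by simpa using h.1.append w, safeExt_append h.2 w⟩

/-! ### Finite index and pumping. -/

section Finiteness

theorem sim_of_profile_eq {Q : Type*} [Finite Q] {A : CoBuchiAut α Q} {u v : List α}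
    (h : A.profile u = A.profile v) : Sim A.language u v :=
  append_mem_language_iff_of_profile h

theorem Live.of_profile {Q : Type*} [Finite Q] {A : CoBuchiAut α Q} {u v u' v' : List α}
    (hu : A.profile u = A.profile u') (hv : A.profile v = A.profile v') (hne : v = [] ↔ v' = [])
    (h : Live A.language u v) : Live A.language u' v' := by
  rw [live_iff] at *
  rcases h with h | ⟨y, h1, h2⟩
  · exact Or.inl (hne.1 h)
  · by_cases hv' : v' = []
    · exact Or.inl hv'
    · refine Or.inr ⟨y, ?_, h2.of_profile hu (profile_append hv rfl) (by simp [hv'])⟩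
      exact ((sim_of_profile_eq (profile_append (profile_append hu hv) rfl)).symm.trans h1).trans
        (sim_of_profile_eq hu)

theorem finite_quotient (hL : IsCoBuchi L) : Finite (Quotient (equivSetoid L)) := by
  obtain ⟨Q, _, A, rfl⟩ := hL
  -- Emptiness of the second word is recorded separately because `(u, ε)` is live by convention.
  let f : List α × List α → ((Q → Q → Prop) × (Q → Q → Prop)) ×
      ((Q → Q → Prop) × (Q → Q → Prop)) × Prop := fun p =>
    (A.profile p.1, A.profile p.2, p.2 = [])
  have hf : ∀ p q, f p = f q → cls A.language p = cls A.language q := by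
    rintro ⟨u, v⟩ ⟨u', v'⟩ h
    simp only [f, Prod.mk.injEq, eq_iff_iff] at h
    obtain ⟨h1, h2, h3⟩ := h
    refine cls_eq_iff.2 ⟨sim_of_profile_eq (profile_append h1 h2), Set.ext fun x => ?_⟩
    exact ⟨fun hx => Live.of_profile h1 (profile_append h2 rfl) (by simp [h3]) hx,
      fun hx => Live.of_profile h1.symm (profile_append h2.symm rfl) (by simp [h3]) hx⟩
  refine Finite.of_injective (fun c : Quotient (equivSetoid A.language) => f c.out) ?_
  intro c c' h
  have := hf _ _ h
  simpa [cls] using this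

theorem finite_canState (hL : IsCoBuchi L) : Finite (CanState L) := by
  have := finite_quotient hL
  exact Subtype.finite

theorem finite_range_safeExt (hL : IsCoBuchi L) : (Set.range (safeExt L)).Finite := by
  have := finite_quotient hL
  refine (Set.finite_range (Quotient.lift (s := equivSetoid L) (safeExt L)
    fun _ _ h => h.2)).subset ?_
  rintro _ ⟨p, rfl⟩
  exact ⟨cls L p, rfl⟩

/-- Take an accepting run on `u(v x^N y)^ω`. In a late copy of the loop it is safe, and two
positions between the powers of `x` carry the same state, which gives a safe cycle on a power of
`x`. -/
theorem exists_lassoMem_of_live_wordPow (hL : IsCoBuchi L) : ∃ N, ∀ u v x : List α, x ≠ [] →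
    Sim L (u ++ v ++ x) (u ++ v) → Live L u (v ++ wordPow x N) → LassoMem L (u ++ v) x := by
  obtain ⟨Q, _, A, rfl⟩ := hL
  -- One more position than there are states forces a repetition.
  refine ⟨Nat.card Q + 1, fun u v x hx hs h => ?_⟩
  set N := Nat.card Q + 1 with hN
  rcases live_iff.1 h with h | ⟨y, h1, h2, h3⟩
  · exact absurd (List.append_eq_nil_iff.1 h).2 (wordPow_ne_nil hx (by omega))
  · obtain ⟨r, M, h0, hr, hsafe⟩ := exists_run_of_mem h3
    set c := v ++ wordPow x N ++ y with hc
    -- The `M` copies of `c` lead past the last 1-transition, while `pre i` remains in the `∼`-class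
    -- of `u v`.
    let pre : ℕ → List α := fun i => u ++ wordPow c M ++ v ++ wordPow x i
    have hword : ∀ i, i ≤ N → u ++ₛ Stream'.cycle c h2 =
        pre i ++ₛ (wordPow x (N - i) ++ₛ (y ++ₛ Stream'.cycle c h2)) := by
      intro i hi
      conv_lhs => rw [cycle_eq_wordPow_append h2 M, Stream'.cycle_eq]
      simp only [pre, ← Stream'.append_append_stream]
      have hx' : wordPow x i ++ wordPow x (N - i) = wordPow x N := by
        rw [← wordPow_add, Nat.add_sub_cancel' hi]
      have hc' : c = v ++ (wordPow x i ++ (wordPow x (N - i) ++ y)) := by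
        rw [← List.append_assoc (wordPow x i), hx', hc, List.append_assoc]
      congr 1
      simp only [List.append_assoc]
      rw [← hc']
    obtain ⟨i, j, hij, hq⟩ : ∃ i j : Fin N, i < j ∧ r (pre i).length = r (pre j).length := by
      have : ¬ Function.Injective fun i : Fin N => r (pre i).length := by
        intro hinj
        have := Nat.card_le_card_of_injective _ hinj
        rw [Nat.card_fin] at this
        omega
      obtain ⟨i, j, h, hne⟩ := Function.not_injective_iff.1 this
      rcases lt_or_gt_of_ne hne with h' | h'
      · exact ⟨i, j, h', h⟩
      · exact ⟨j, i, h', h.symm⟩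
    have hpre : pre i ++ wordPow x (j - i) = pre j := by
      simp only [pre, List.append_assoc]
      rw [← wordPow_add, Nat.add_sub_cancel' hij.le]
    have hpath : Paths A.SafeStep (wordPow x (j - i)) (r (pre i).length) (r (pre i).length) := by
      have := hsafe (pre i) (wordPow x (j - i)) _ ?_ ((hword j j.2.le).trans (by rw [hpre]))
      · rwa [hpre, ← hq] at this
      · have := le_length_wordPow h2 M
        simp only [pre, List.length_append]
        omega
    have hl : LassoMem A.language (pre i) (wordPow x (j - i)) := by
      have hij' : (j : ℕ) - i ≠ 0 := by
        have : (i : ℕ) < j := hij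
        omega
      exact lassoMem_language_iff.2 ⟨wordPow_ne_nil hx hij', 0, r 0, h0, _,
        by simpa using hr _ _ (hword i i.2.le), fun n => ⟨_, paths_wordPow_self hpath n⟩⟩
    rw [lassoMem_wordPow_iff (by have : (i : ℕ) < j := hij; omega)] at hl
    have hsim : Sim A.language (pre i) (u ++ v) := by
      have h4 : Sim A.language (u ++ c) u := by simpa [hc] using h1
      exact (((h4.wordPow M).append v).append _).trans (hs.wordPow _)
    exact hsim.lassoMem_iff.1 hl

theorem lassoMem_of_forall_live_wordPow (hL : IsCoBuchi L) {u v x : List α} (hx : x ≠ [])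
    (hs : Sim L (u ++ v ++ x) (u ++ v)) (h : ∀ n, Live L u (v ++ wordPow x n)) :
    LassoMem L (u ++ v) x := by
  obtain ⟨N, hN⟩ := exists_lassoMem_of_live_wordPow hL
  exact hN u v x hx hs (h N)

end Finiteness

/-! ### Pointed pairs. -/

section Pointed

theorem Pointed.live {u v : List α} (h : Pointed L (u, v)) : Live L u v := h.1

theorem Pointed.safeExt_eq {u v u₁ u₂ : List α} (h : Pointed L (u, v))
    (hs : Sim L (u₁ ++ u₂) u) (hl : Live L u₁ (u₂ ++ v)) :
    safeExt L (u, v) = safeExt L (u₁, u₂ ++ v) := h.2 u₁ u₂ hs hl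

theorem Pointed.cls_eq {u v u₁ u₂ : List α} (h : Pointed L (u, v))
    (hs : Sim L (u₁ ++ u₂) u) (hl : Live L u₁ (u₂ ++ v)) :
    cls L (u₁, u₂ ++ v) = cls L (u, v) :=
  cls_eq_iff.2 ⟨by simpa using hs.append v, (h.safeExt_eq hs hl).symm⟩

theorem Pointed.append {u v w : List α} (h : Pointed L (u, v)) (hl : Live L u (v ++ w)) :
    Pointed L (u, v ++ w) := by
  refine ⟨hl, fun u₁ u₂ hs hl' => ?_⟩
  have hl'' : Live L u₁ ((u₂ ++ v) ++ w) := by simpa using hl'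
  have := safeExt_append (h.safeExt_eq hs hl''.of_append) w
  simpa using this

theorem Pointed.left {u v u₁ u₂ : List α} (h : Pointed L (u, v)) (hs : Sim L (u₁ ++ u₂) u)
    (hl : Live L u₁ (u₂ ++ v)) : Pointed L (u₁, u₂ ++ v) := by
  refine ⟨hl, fun s t hs' hl' => ?_⟩
  rw [← List.append_assoc] at hl'
  have hst : Sim L (s ++ (t ++ u₂)) u := by simpa using (hs'.append u₂).trans hs
  have h1 := h.safeExt_eq hs hl
  have h2 := h.safeExt_eq hst hl'
  simpa using h1.symm.trans h2

/-- Choose the left extension whose set of safe extensions is minimal among the finitely many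
possible ones; by `safeExt_subset_left` further moves to the left only give subsets. -/
theorem Live.exists_pointed_left (hL : IsCoBuchi L) {u v : List α} (h : Live L u v) :
    ∃ u₁ u₂, Sim L (u₁ ++ u₂) u ∧ Pointed L (u₁, u₂ ++ v) := by
  let S : Set (Set (List α)) := {s | ∃ u₁ u₂, Sim L (u₁ ++ u₂) u ∧ Live L u₁ (u₂ ++ v) ∧
    s = safeExt L (u₁, u₂ ++ v)}
  have hfin : S.Finite := (finite_range_safeExt hL).subset (by
    rintro _ ⟨u₁, u₂, -, -, rfl⟩
    exact ⟨_, rfl⟩)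
  have hne : S.Nonempty := ⟨_, u, [], by simpa using Sim.refl u, h, rfl⟩
  obtain ⟨s, hs⟩ := hfin.exists_minimal hne
  obtain ⟨u₁, u₂, h1, h2, rfl⟩ := hs.prop
  refine ⟨u₁, u₂, h1, h2, fun s t hst hl => ?_⟩
  have hsub : safeExt L (s, t ++ (u₂ ++ v)) ⊆ safeExt L (u₁, u₂ ++ v) := by
    rw [← safeExt_congr hst]
    exact safeExt_subset_left _ _ _
  refine subset_antisymm (hs.le_of_le ?_ hsub) hsub
  refine ⟨s, t ++ u₂, ?_, by simpa using hl, by simp⟩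
  simpa using (hst.append u₂).trans h1

/-- Make `(u₁, u₂z)` pointed by extending to the left, and close it to a loop `u₂zy`. Two turns of
the loop contain `z y u₂ z`, which reaches the pointed end while starting with `z`. -/
theorem Live.exists_pointed_right (hL : IsCoBuchi L) {u z : List α} (h : Live L u z) :
    ∃ v, Pointed L (u, z ++ v) := by
  obtain ⟨u₁, u₂, hs, hp⟩ := h.exists_pointed_left hL
  obtain ⟨y, h1, h2⟩ := hp.live.exists_return
  have h3 : Live L u (z ++ y ++ (u₂ ++ z)) := by
    have h4 : Live L u₁ (u₂ ++ (z ++ y ++ (u₂ ++ z))) := by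
      refine Live.of_append (x := y) ?_
      simpa [wordPow_succ] using h2 2
    exact h4.of_left.congr hs
  refine ⟨y ++ (u₂ ++ z), ?_⟩
  rw [← List.append_assoc]
  refine hp.left ?_ h3
  have := (hs.symm.append (z ++ y)).trans (by simpa using h1)
  simpa using this

theorem Pointed.cls_loop {u v y : List α} (h : Pointed L (u, v)) (hs : Sim L (u ++ (v ++ y)) u)
    (hl : Live L u (v ++ y ++ v)) : cls L (u, v ++ y ++ v) = cls L (u, v) :=
  h.cls_eq hs hl

/-- This is what makes components strongly connected: close the loop and read `v` again; pointedness
identifies the class reached. -/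
theorem Pointed.exists_return {u v w : List α} (h : Pointed L (u, v))
    (hl : Live L u (v ++ w)) : ∃ y, Sim L (u ++ (v ++ (w ++ y))) u ∧
      Live L u (v ++ (w ++ y) ++ v) ∧ cls L (u, v ++ (w ++ y) ++ v) = cls L (u, v) := by
  obtain ⟨y, h1, h2⟩ := hl.exists_return
  have hs : Sim L (u ++ (v ++ (w ++ y))) u := by simpa using h1
  have hl' : Live L u (v ++ (w ++ y) ++ v) := by
    refine Live.of_append (x := w ++ y) ?_
    simpa [wordPow_succ] using h2 2
  exact ⟨y, hs, hl', h.cls_loop hs hl'⟩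

theorem Pointed.lassoMem_iff (hL : IsCoBuchi L) {u v y : List α} (h : Pointed L (u, v))
    (hne : v ++ y ≠ []) (hs : Sim L (u ++ (v ++ y)) u) :
    LassoMem L u (v ++ y) ↔ Live L u (v ++ y ++ v) := by
  constructor
  · intro hl
    refine Live.of_append (x := y) ?_
    simpa [wordPow_succ] using live_wordPow hs hl 2
  · intro hl
    -- After `n` turns the safe extensions are still those of `(u, v)`, so one more turn is live.
    have key : ∀ n, Live L u (wordPow (v ++ y) n ++ v) := by
      intro n
      induction n with
      | zero => exact h.live
      | succ n ih =>
        have e := h.safeExt_eq (hs.wordPow n) ih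
        have := (live_append_iff_of_safeExt_eq e (y ++ v)).1 (by simpa using hl)
        rw [wordPow_succ']
        simpa using this
    have := lassoMem_of_forall_live_wordPow hL (u := u) (v := []) hne (by simpa using hs)
      fun n => (key n).of_append
    simpa using this

theorem Approx.cls_eq {u v u' v' : List α} (h : Approx L (u, v) (u', v')) :
    cls L (u, v) = cls L (u', v') := by
  obtain ⟨h1, h2, h3, h4, h5⟩ := h
  dsimp only at h1 h2 h3 h4 h5
  refine cls_eq_iff.2 ⟨h4, Set.ext fun x => ?_⟩
  change Live L u (v ++ x) ↔ Live L u' (v' ++ x)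
  simp only [live_iff, List.append_eq_nil_iff, h1, h2, false_and, false_or]
  refine exists_congr fun y => ?_
  have e : Sim L (u ++ (v ++ x) ++ y) u ↔ Sim L (u' ++ (v' ++ x) ++ y) u' := by
    have := h4.append (x ++ y)
    simp only [List.append_assoc] at *
    exact ⟨fun h => (this.symm.trans h).trans h3, fun h => (this.trans h).trans h3.symm⟩
  rw [← e]
  refine and_congr_right fun hs => ?_
  simpa using h5 (x ++ y) (by simpa using hs)

/-- By `Pointed.lassoMem_iff`, membership of `u(vwx)^ω` is liveness of `(u, vwxv)`, which depends
only on the `≡`-class of `(u, vw)`. -/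
theorem Pointed.approx_iff (hL : IsCoBuchi L) {u v w w' : List α} (h : Pointed L (u, v))
    (hv : v ≠ []) :
    Approx L (u, v ++ w) (u, v ++ w') ↔ cls L (u, v ++ w) = cls L (u, v ++ w') := by
  refine ⟨Approx.cls_eq, fun hc => ?_⟩
  obtain ⟨h1, h2⟩ := cls_eq_iff.1 hc
  refine ⟨by simp [hv], by simp [hv], Sim.refl u, h1, fun x hx => ?_⟩
  dsimp only at *
  have hx' : Sim L (u ++ (v ++ w') ++ x) u := (h1.symm.append x).trans hx
  have e1 := h.lassoMem_iff hL (y := w ++ x) (by simp [hv]) (by simpa using hx)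
  have e2 := h.lassoMem_iff hL (y := w' ++ x) (by simp [hv]) (by simpa using hx')
  have e3 := live_append_iff_of_safeExt_eq h2 (x ++ v)
  simp only [List.append_assoc] at *
  rw [e1, e2, e3]

end Pointed

end Congruence

/-! ### The length-lexicographic order. -/

section Shortlex

variable {α : Type*} [LinearOrder α]

theorem shortlex_append_same {s t : List α} (h : List.Shortlex (· < ·) s t) (w : List α) :
    List.Shortlex (· < ·) (s ++ w) (t ++ w) := by
  rcases List.shortlex_def.1 h with hl | ⟨hl, hlex⟩
  · exact List.Shortlex.of_length_lt (by simpa using hl)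
  · refine List.Shortlex.of_lex (by simpa using hl) ?_
    clear h
    induction hlex with
    | nil => simp at hl
    | cons _ ih => exact List.Lex.cons (ih (by simpa using hl))
    | rel h => exact List.Lex.rel h

theorem shortlex_asymm {s t : List α} (h : List.Shortlex (· < ·) s t) :
    ¬ List.Shortlex (· < ·) t s :=
  Std.Asymm.asymm (r := List.Shortlex (α := α) (· < ·)) _ _ h

theorem shortlex_or_of_ne {s t : List α} (h : s ≠ t) :
    List.Shortlex (· < ·) s t ∨ List.Shortlex (· < ·) t s := by
  by_contra! hcon
  exact h (Std.Trichotomous.trichotomous (r := List.Shortlex (α := α) (· < ·)) _ _ hcon.1 hcon.2)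

theorem exists_isSmallest [Finite α] {S : Set (List α)} (hS : S.Nonempty) :
    ∃ w, IsSmallest S w := by
  have wf : WellFounded (List.Shortlex (α := α) (· < ·)) := List.Shortlex.wf wellFounded_lt
  refine ⟨wf.min S hS, wf.min_mem S hS, fun w' hw' hne => ?_⟩
  exact (shortlex_or_of_ne hne).resolve_left (wf.not_lt_min S hw')

end Shortlex

/-! ### Faithful components. -/

section Components

variable {α : Type*} {L : Set (Stream' α)}

theorem live_of_cls_eq {u v u' v' : List α} (h : cls L (u, v) = cls L (u', v'))
    (hl : Live L u v) : Live L u' v' := by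
  have := (live_append_iff_of_safeExt_eq (cls_eq_iff.1 h).2 []).1 (by simpa using hl)
  simpa using this

/-- The components whose states are pointed and represent, without repetitions, the classes of a
safe SCC of the canonical automaton, with its 2-transitions. -/
structure Faithful (L : Set (Stream' α)) (C : Component α) : Prop where
  pointed : ∀ p ∈ C.states, Pointed L p
  trans_iff : ∀ p ∈ C.states, ∀ a, ∀ q ∈ C.states,
    C.trans p a q ↔ cls L (p.1, p.2 ++ [a]) = cls L q
  closed : ∀ p ∈ C.states, ∀ w, Live L p.1 (p.2 ++ w) →
    ∃ q ∈ C.states, cls L q = cls L (p.1, p.2 ++ w)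
  injective : ∀ p ∈ C.states, ∀ q ∈ C.states, cls L p = cls L q → p = q
  connected : ∀ p ∈ C.states, ∀ q ∈ C.states, ∃ w, cls L (p.1, p.2 ++ w) = cls L q

/-- A component with at most `d` states in which `x ^ d` is safe from a state has a state from
which all powers of `x` are safe. -/
theorem Faithful.exists_forall_live {C : Component α} (hC : Faithful L C) {d : ℕ}
    (hd : C.states.encard ≤ d) {p : List α × List α} (hp : p ∈ C.states) {x : List α}
    (hl : Live L p.1 (p.2 ++ wordPow x d)) :
    ∃ q ∈ C.states, ∃ i, cls L q = cls L (p.1, p.2 ++ wordPow x i) ∧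
      ∀ n, Live L q.1 (q.2 ++ wordPow x n) := by
  have hlive : ∀ i : Fin (d + 1), Live L p.1 (p.2 ++ wordPow x i) := by
    intro i
    refine Live.of_append (x := wordPow x (d - i)) ?_
    rwa [List.append_assoc, ← wordPow_add, Nat.add_sub_cancel' (Nat.lt_succ_iff.1 i.2)]
  choose s hs hsc using fun i : Fin (d + 1) => hC.closed p hp _ (hlive i)
  have hfin : C.states.Finite := Set.finite_of_encard_le_coe hd
  -- The states after `x^0, …, x^d` are `d + 1` in number, so two of them coincide.
  obtain ⟨i, j, hij, hsij⟩ : ∃ i j, i < j ∧ s i = s j := by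
    have : ¬ Function.Injective s := by
      intro hinj
      have h1 : (Set.range s).encard = ((d + 1 : ℕ) : ℕ∞) := by
        rw [← Set.image_univ, hinj.encard_image, Set.encard_univ]
        simp
      have h2 := (Set.encard_le_encard (Set.range_subset_iff.2 hs)).trans hd
      rw [h1, Nat.cast_le] at h2
      omega
    obtain ⟨i, j, h, hne⟩ := Function.not_injective_iff.1 this
    rcases lt_or_gt_of_ne hne with h' | h'
    · exact ⟨i, j, h', h⟩
    · exact ⟨j, i, h', h.symm⟩
  refine ⟨s i, hs i, i, hsc i, fun n => ?_⟩
  have hk : (j : ℕ) - i ≠ 0 := by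
    have : (i : ℕ) < j := hij
    omega
  set y := wordPow x (j - i) with hy
  have hloop : cls L ((s i).1, (s i).2 ++ y) = cls L (s i) := by
    refine (cls_append (hsc i) y).trans ?_
    rw [List.append_assoc, hy, ← wordPow_add, Nat.add_sub_cancel' (le_of_lt hij), ← hsc j, hsij]
  have hloops : ∀ n, cls L ((s i).1, (s i).2 ++ wordPow y n) = cls L (s i) := by
    intro n
    induction n with
    | zero => simp
    | succ n ih =>
      rw [wordPow_succ', ← List.append_assoc]
      exact (cls_append ih y).trans hloop
  have hln : Live L (s i).1 ((s i).2 ++ wordPow y n) :=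
    live_of_cls_eq (hloops n).symm (hC.pointed _ (hs i)).1
  -- `x^n` is a prefix of `y^n`, so liveness of the latter suffices.
  have hle : n ≤ (j - i) * n := Nat.le_mul_of_pos_left _ (Nat.pos_of_ne_zero hk)
  rw [hy, ← wordPow_mul, ← Nat.add_sub_cancel' hle, wordPow_add, ← List.append_assoc] at hln
  exact hln.of_append

/-! ### Components built by the learner. -/

section comp

variable [LinearOrder α]

theorem mem_comp_iff {u v u' v' : List α} : (u', v') ∈ (comp L (u, v)).states ↔
    ∃ w, u' = u ∧ v' = v ++ w ∧ Live L u (v ++ w) ∧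
      ∀ w', List.Shortlex (· < ·) w' w → ¬ Approx L (u, v ++ w) (u, v ++ w') := by
  constructor
  · rintro ⟨w, h1, h2, h3⟩
    obtain ⟨rfl, rfl⟩ := Prod.mk.inj h1
    exact ⟨w, rfl, rfl, h2, h3⟩
  · rintro ⟨w, rfl, rfl, h2, h3⟩
    exact ⟨w, rfl, h2, h3⟩

/-- The smallest word of an `≡`-class gives a state, because `≈` implies `≡`; this needs no
pointedness. -/
theorem exists_mem_comp [Finite α] {u v w : List α}
    (hl : Live L u (v ++ w)) : ∃ p ∈ (comp L (u, v)).states, cls L p = cls L (u, v ++ w) := by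
  obtain ⟨w₀, h1, h2⟩ := exists_isSmallest
    (S := {w' | cls L (u, v ++ w') = cls L (u, v ++ w)}) ⟨w, rfl⟩
  refine ⟨(u, v ++ w₀), mem_comp_iff.2 ⟨w₀, rfl, rfl, live_of_cls_eq h1.symm hl,
    fun w' hw' ha => ?_⟩, h1⟩
  refine shortlex_asymm hw' (h2 w' (ha.cls_eq.symm.trans h1) ?_)
  rintro rfl
  exact shortlex_asymm hw' hw'

theorem Pointed.faithful_comp [Finite α] (hL : IsCoBuchi L) {u v : List α} (h : Pointed L (u, v))
    (hv : v ≠ []) : Faithful L (comp L (u, v)) := by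
  refine ⟨?_, ?_, ?_, ?_, ?_⟩
  · rintro ⟨u', v'⟩ hp
    obtain ⟨w, rfl, rfl, hl, -⟩ := mem_comp_iff.1 hp
    exact h.append hl
  · rintro ⟨u', v'⟩ hp a ⟨u'', v''⟩ hq
    obtain ⟨w, rfl, rfl, hl, -⟩ := mem_comp_iff.1 hp
    obtain ⟨w', rfl, rfl, hl', -⟩ := mem_comp_iff.1 hq
    have := h.approx_iff hL (w := w ++ [a]) (w' := w') hv
    rw [← List.append_assoc] at this
    rw [← this]
    exact ⟨fun h => h.2.2, fun h => ⟨hp, hq, h⟩⟩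
  · rintro ⟨u', v'⟩ hp w' hl'
    obtain ⟨w, rfl, rfl, hl, -⟩ := mem_comp_iff.1 hp
    simp only [List.append_assoc] at *
    exact exists_mem_comp hl'
  · rintro ⟨u', v'⟩ hp ⟨u'', v''⟩ hq hc
    obtain ⟨w, rfl, rfl, hl, hmin⟩ := mem_comp_iff.1 hp
    obtain ⟨w', rfl, rfl, hl', hmin'⟩ := mem_comp_iff.1 hq
    by_contra hne
    have hne' : w ≠ w' := fun h => hne (h ▸ rfl)
    rcases shortlex_or_of_ne hne' with hlt | hlt
    · exact hmin' w hlt ((h.approx_iff hL hv).2 hc.symm)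
    · exact hmin w' hlt ((h.approx_iff hL hv).2 hc)
  · rintro ⟨u', v'⟩ hp ⟨u'', v''⟩ hq
    obtain ⟨w, rfl, rfl, hl, -⟩ := mem_comp_iff.1 hp
    obtain ⟨w', rfl, rfl, -⟩ := mem_comp_iff.1 hq
    obtain ⟨y, -, -, hc⟩ := h.exists_return hl
    refine ⟨y ++ (v ++ w'), ?_⟩
    simpa using cls_append hc w'

theorem eq_nil_of_live_of_notMem_NTSim {u w : List α} (hu : u ∈ RSim L \ NTSim L)
    (h : Live L u w) : w = [] := by
  rcases live_iff.1 h with h | ⟨x, h1, h2⟩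
  · exact h
  · exact absurd ⟨hu.1, w ++ x, by simpa using h1, h2⟩ hu.2

theorem pointed_nil_of_notMem_NTSim {u : List α} (hu : u ∈ RSim L \ NTSim L) :
    Pointed L (u, []) := by
  refine ⟨live_nil u, fun u₁ u₂ hs hl => subset_antisymm (fun x (hx : Live L u x) => ?_) ?_⟩
  · obtain rfl := eq_nil_of_live_of_notMem_NTSim hu hx
    simpa [safeExt] using hl
  · rw [← safeExt_congr hs]
    exact safeExt_subset_left _ _ _

theorem states_comp_of_notMem_NTSim {u : List α} (hu : u ∈ RSim L \ NTSim L) :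
    (comp L (u, [])).states = {(u, [])} := by
  ext ⟨u', v'⟩
  rw [mem_comp_iff]
  constructor
  · rintro ⟨w, rfl, rfl, hl, -⟩
    obtain rfl := eq_nil_of_live_of_notMem_NTSim hu hl
    rfl
  · intro h
    obtain ⟨rfl, rfl⟩ := Prod.mk.inj h
    exact ⟨[], rfl, rfl, live_nil _, fun w' _ h => h.1 rfl⟩

theorem faithful_comp_of_notMem_NTSim {u : List α} (hu : u ∈ RSim L \ NTSim L) :
    Faithful L (comp L (u, [])) := by
  have hst := states_comp_of_notMem_NTSim hu
  refine ⟨?_, ?_, ?_, ?_, ?_⟩ <;> simp only [hst, Set.mem_singleton_iff, forall_eq]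
  · exact pointed_nil_of_notMem_NTSim hu
  -- The component has no transition, as `≈` fails when a second word is empty; no class of `(u,
  -- [a])` matches either, as `(u, [a])` is not live.
  · refine fun a => ⟨fun h => absurd rfl h.2.2.2.1, fun h => ?_⟩
    exact absurd (eq_nil_of_live_of_notMem_NTSim hu (live_of_cls_eq h.symm (live_nil u)))
      (by simp)
  · intro w hl
    obtain rfl := eq_nil_of_live_of_notMem_NTSim hu hl
    exact ⟨_, rfl, rfl⟩
  · simp
  · exact ⟨[], rfl⟩

end comp

/-! ### The canonical automaton and its safe SCCs. -/

section Canonical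

theorem canonical_init_iff {p : List α × List α} (hp : Pointed L p) :
    CanState.mk L p hp ∈ (canonical L).init ↔ Sim L (p.1 ++ p.2) [] := by
  constructor
  · rintro ⟨q, -, hc, hs⟩
    exact (cls_eq_iff.1 hc).1.trans hs
  · exact fun h => ⟨p, hp, rfl, h⟩

theorem canonical_two_iff {p q : List α × List α} (hp : Pointed L p) (hq : Pointed L q) {a : α} :
    (canonical L).trans (CanState.mk L p hp) a Rank.two (CanState.mk L q hq) ↔
      cls L (p.1, p.2 ++ [a]) = cls L q := by
  constructor
  · rintro ⟨p', -, hc, -, hc'⟩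
    exact (cls_append hc [a]).trans hc'.symm
  · exact fun h => ⟨p, hp, rfl, live_of_cls_eq h.symm hq.1, h.symm⟩

theorem canonical_one_iff {p q : List α × List α} (hp : Pointed L p) (hq : Pointed L q) {a : α} :
    (canonical L).trans (CanState.mk L p hp) a Rank.one (CanState.mk L q hq) ↔
      Sim L (p.1 ++ p.2 ++ [a]) (q.1 ++ q.2) := by
  constructor
  · rintro ⟨p', q', -, -, hc, hc', hs⟩
    exact (((cls_eq_iff.1 hc).1.append [a]).trans hs).trans (cls_eq_iff.1 hc').1.symm
  · exact fun h => ⟨p, q, hp, hq, rfl, rfl, h⟩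

theorem CanState.mk_eq_mk {p q : List α × List α} (hp : Pointed L p) (hq : Pointed L q)
    (h : cls L p = cls L q) : CanState.mk L p hp = CanState.mk L q hq := Subtype.ext h

theorem reflTransGen_safeEdge {p q : List α × List α} (hp : Pointed L p) (hq : Pointed L q)
    {w : List α} (h : cls L (p.1, p.2 ++ w) = cls L q) :
    Relation.ReflTransGen (canonical L).SafeEdge (CanState.mk L p hp) (CanState.mk L q hq) := by
  induction w generalizing p with
  | nil =>
    rw [CanState.mk_eq_mk hp hq (by simpa using h)]
  | cons a w ih =>
    have h' : cls L (p.1, (p.2 ++ [a]) ++ w) = cls L q := by simpa using h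
    have hl : Live L p.1 (p.2 ++ [a]) := (live_of_cls_eq h'.symm hq.1).of_append
    have hp' : Pointed L (p.1, p.2 ++ [a]) := Pointed.append hp hl
    exact (Relation.ReflTransGen.single ⟨a, (canonical_two_iff hp hp').2 rfl⟩).trans (ih hp' h')

theorem Faithful.isSafeSCCOf {C : Component α} (hC : Faithful L C) {p : List α × List α}
    (hp : p ∈ C.states) {c : CanState L} (hc : c.1 = cls L p) : IsSafeSCCOf L C c := by
  obtain rfl : c = CanState.mk L p (hC.pointed p hp) := Subtype.ext hc
  let f : C.states → (canonical L).safeSCC (CanState.mk L p (hC.pointed p hp)) := fun q =>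
    ⟨CanState.mk L q.1 (hC.pointed q.1 q.2), by
      obtain ⟨w, hw⟩ := hC.connected p hp q.1 q.2
      obtain ⟨w', hw'⟩ := hC.connected q.1 q.2 p hp
      exact ⟨reflTransGen_safeEdge _ _ hw, reflTransGen_safeEdge _ _ hw'⟩⟩
  have hf : Function.Bijective f := by
    constructor
    · intro q q' h
      have h1 : cls L q.1 = cls L q'.1 := congrArg (fun c => c.1.1) h
      exact Subtype.ext (hC.injective _ q.2 _ q'.2 h1)
    · rintro ⟨c, hc1, hc2⟩
      -- Forward reachability alone suffices here: `closed` keeps every 2-path from `p` inside the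
      -- component.
      have key : ∃ q ∈ C.states, cls L q = c.1 := by
        clear hc2
        induction hc1 with
        | refl => exact ⟨p, hp, rfl⟩
        | tail _ he ih =>
          obtain ⟨q, hq, hqc⟩ := ih
          obtain ⟨a, q', -, h1, h2, h3⟩ := he
          have h4 := cls_append (hqc.trans h1) [a]
          obtain ⟨r, hr, hrc⟩ := hC.closed q hq [a] (live_of_cls_eq h4.symm h2)
          exact ⟨r, hr, hrc.trans (h4.trans h3.symm)⟩
      obtain ⟨q, hq, hqc⟩ := key
      exact ⟨⟨q, hq⟩, Subtype.ext (Subtype.ext hqc)⟩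
  refine ⟨Equiv.ofBijective f hf, fun q => rfl, fun q a q' => ?_⟩
  rw [hC.trans_iff _ q.2 _ _ q'.2]
  exact (canonical_two_iff (hC.pointed _ q.2) (hC.pointed _ q'.2)).symm

end Canonical

/-! ### Acceptance by unions of faithful components. -/

section Union

variable {𝒞 : Set (Component α)}

theorem cls_of_safePaths (h𝒞 : ∀ C ∈ 𝒞, Faithful L C) {z : List α} {p q : UnionState 𝒞}
    (h : Paths (autOf L 𝒞).SafeStep z p q) : cls L (p.1.1, p.1.2 ++ z) = cls L q.1 := by
  induction z generalizing p with
  | nil =>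
    have : p = q := h
    simp [this]
  | cons a z ih =>
    obtain ⟨r, ⟨C, hC, hp, hr, ht⟩, hz⟩ := h
    have := cls_append (((h𝒞 C hC).trans_iff _ hp _ _ hr).1 ht) z
    simpa using this.trans (ih hz)

theorem exists_safePaths (h𝒞 : ∀ C ∈ 𝒞, Faithful L C) {C : Component α} (hC : C ∈ 𝒞)
    {z : List α} {p : UnionState 𝒞} (hp : p.1 ∈ C.states) (h : Live L p.1.1 (p.1.2 ++ z)) :
    ∃ q : UnionState 𝒞, Paths (autOf L 𝒞).SafeStep z p q := by
  induction z generalizing p with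
  | nil => exact ⟨p, rfl⟩
  | cons a z ih =>
    have h' : Live L p.1.1 (p.1.2 ++ [a] ++ z) := by simpa using h
    obtain ⟨r, hr, hrc⟩ := (h𝒞 C hC).closed _ hp [a] h'.of_append
    have hr' : Live L r.1 (r.2 ++ z) := live_of_cls_eq (cls_append hrc.symm z) h'
    obtain ⟨q, hq⟩ := ih (p := ⟨r, C, hC, hr⟩) hr hr'
    exact ⟨q, ⟨r, C, hC, hr⟩, ⟨C, hC, hp, hr, ((h𝒞 C hC).trans_iff _ hp _ _ hr).2 hrc.symm⟩, hq⟩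

theorem sim_of_paths (h𝒞 : ∀ C ∈ 𝒞, Faithful L C) {z : List α} {p q : UnionState 𝒞}
    (h : Paths (autOf L 𝒞).Step z p q) : Sim L (p.1.1 ++ p.1.2 ++ z) (q.1.1 ++ q.1.2) := by
  induction z generalizing p with
  | nil =>
    have : p = q := h
    simpa [this] using Sim.refl _
  | cons a z ih =>
    obtain ⟨r, ⟨i, hi⟩, hz⟩ := h
    have h1 : Sim L (p.1.1 ++ p.1.2 ++ [a]) (r.1.1 ++ r.1.2) := by
      cases i with
      | one => exact hi
      | two =>
        obtain ⟨C, hC, hp, hr, ht⟩ := hi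
        simpa using (cls_eq_iff.1 (((h𝒞 C hC).trans_iff _ hp _ _ hr).1 ht)).1
    simpa using (h1.append z).trans (ih hz)

/-- The path uses only 1-transitions, which may enter any state of the right class; hence each
proper prefix of `u` needs a state. -/
theorem exists_paths_of_prefixes {u : List α}
    (hpre : ∀ u' t, t ≠ [] → u = u' ++ t → ∃ q : UnionState 𝒞, Sim L (q.1.1 ++ q.1.2) u')
    {q : UnionState 𝒞} (hq : Sim L (q.1.1 ++ q.1.2) u) :
    ∃ q₀ ∈ (autOf L 𝒞).init, Paths (autOf L 𝒞).Step u q₀ q := by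
  induction u using List.reverseRecOn generalizing q with
  | nil => exact ⟨q, hq, rfl⟩
  | append_singleton u a ih =>
    obtain ⟨p, hp⟩ := hpre u [a] (by simp) rfl
    obtain ⟨q₀, h0, h⟩ := ih (fun u' t ht h => hpre u' (t ++ [a]) (by simp) (by simp [h])) hp
    exact ⟨q₀, h0, paths_append.2 ⟨p, h, q, ⟨Rank.one, (hp.append [a]).trans hq.symm⟩, rfl⟩⟩

theorem lassoMem_autOf [Finite (UnionState 𝒞)] (h𝒞 : ∀ C ∈ 𝒞, Faithful L C) {u x : List α}
    (hpre : ∀ u' t, t ≠ [] → u = u' ++ t → ∃ q : UnionState 𝒞, Sim L (q.1.1 ++ q.1.2) u')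
    (hx : x ≠ []) {q : UnionState 𝒞} (hq : Sim L (q.1.1 ++ q.1.2) u)
    (hl : ∀ n, Live L q.1.1 (q.1.2 ++ wordPow x n)) : LassoMem (autOf L 𝒞).language u x := by
  obtain ⟨q₀, h0, h⟩ := exists_paths_of_prefixes hpre hq
  obtain ⟨C, hC, hqC⟩ := q.2
  exact lassoMem_language_iff.2 ⟨hx, 0, q₀, h0, q, by simpa using h,
    fun n => exists_safePaths h𝒞 hC hqC (hl n)⟩

/-- Take the state after `u x^m` from which the powers of `x` are safe; paths respect `∼`, and safe
paths track `≡`-classes. -/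
theorem exists_state_of_lassoMem_autOf [Finite (UnionState 𝒞)] (h𝒞 : ∀ C ∈ 𝒞, Faithful L C)
    {u x : List α} (hs : Sim L (u ++ x) u) (h : LassoMem (autOf L 𝒞).language u x) :
    ∃ q : UnionState 𝒞, Sim L (q.1.1 ++ q.1.2) u ∧
      ∀ n, Live L q.1.1 (q.1.2 ++ wordPow x n) := by
  obtain ⟨-, m, q₀, h0, q, hq, hsafe⟩ := lassoMem_language_iff.1 h
  refine ⟨q, ?_, fun n => ?_⟩
  · have h0' : Sim L (q₀.1.1 ++ q₀.1.2) [] := h0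
    exact ((sim_of_paths h𝒞 hq).symm.trans (h0'.append _)).trans (hs.wordPow m)
  · obtain ⟨q', hq'⟩ := hsafe n
    obtain ⟨C, hC, hqC⟩ := q'.2
    exact live_of_cls_eq (cls_of_safePaths h𝒞 hq').symm ((h𝒞 C hC).pointed _ hqC).1

theorem lassoMem_of_lassoMem_autOf (hL : IsCoBuchi L) [Finite (UnionState 𝒞)]
    (h𝒞 : ∀ C ∈ 𝒞, Faithful L C) {u x : List α} (hs : Sim L (u ++ x) u)
    (h : LassoMem (autOf L 𝒞).language u x) : LassoMem L u x := by
  obtain ⟨q, hq, hl⟩ := exists_state_of_lassoMem_autOf h𝒞 hs h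
  exact hq.lassoMem_iff.1 (lassoMem_of_forall_live_wordPow hL h.ne_nil
    (((hq.append x).trans hs).trans hq.symm) hl)

end Union

end Components

/-! ### The learning loop and its invariant. -/

section Learner

variable {α : Type*} [LinearOrder α] {L : Set (Stream' α)}

theorem exists_RSim_sim [Finite α] (u : List α) : ∃ u₀ ∈ RSim L, Sim L u₀ u := by
  obtain ⟨u₀, h1, h2⟩ := exists_isSmallest (S := {u' | Sim L u' u}) ⟨u, Sim.refl u⟩
  exact ⟨u₀, ⟨Sim.refl u₀, fun w hw => h2 w (hw.trans h1)⟩, h1⟩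

theorem eq_of_mem_RSim {u v : List α} (hu : u ∈ RSim L) (hv : v ∈ RSim L) (h : Sim L u v) :
    u = v := by
  by_contra hne
  exact shortlex_asymm (hu.2 v h.symm (Ne.symm hne)) (hv.2 u h hne)

/-- Replacing a prefix by a smaller equivalent word would give a smaller representative of the
whole. -/
theorem mem_RSim_of_append [Finite α] {u t : List α} (h : u ++ t ∈ RSim L) : u ∈ RSim L := by
  obtain ⟨u₀, h0, hs⟩ := exists_RSim_sim (L := L) u
  by_cases hne : u₀ = u
  · exact hne ▸ h0
  · have h1 := shortlex_append_same (h0.2 u hs.symm (Ne.symm hne)) t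
    have h2 := h.2 (u₀ ++ t) (hs.append t) (by simpa using hne)
    exact absurd h1 (shortlex_asymm h2)

theorem finite_RSim (hL : IsCoBuchi L) : (RSim L).Finite := by
  have := finite_quotient hL
  refine Set.Finite.of_finite_image (f := fun u => cls L (u, []))
    (Set.toFinite _) fun u hu v hv h => ?_
  exact eq_of_mem_RSim hu hv (by simpa using (cls_eq_iff.1 h).1)

/-- What the main loop maintains. -/
structure LoopInvariant (L : Set (Stream' α)) (𝒞 : Set (Component α)) : Prop where
  faithful : ∀ C ∈ 𝒞, Faithful L C
  disjoint : ∀ C ∈ 𝒞, ∀ C' ∈ 𝒞, ∀ p ∈ C.states, ∀ q ∈ C'.states, cls L p = cls L q → C = C'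
  trivial_mem : ∀ u ∈ RSim L \ NTSim L, comp L (u, []) ∈ 𝒞

theorem loopInvariant_initComponents : LoopInvariant L (initComponents L) where
  faithful := by
    rintro _ ⟨u, hu, rfl⟩
    exact faithful_comp_of_notMem_NTSim hu
  disjoint := by
    rintro _ ⟨u, hu, rfl⟩ _ ⟨u', hu', rfl⟩
    simp only [states_comp_of_notMem_NTSim hu, states_comp_of_notMem_NTSim hu',
      Set.mem_singleton_iff, forall_eq]
    intro h
    rw [eq_of_mem_RSim hu.1 hu'.1 (by simpa using (cls_eq_iff.1 h).1)]
  trivial_mem := fun u hu => ⟨u, hu, rfl⟩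

namespace LoopInvariant

variable {𝒞 : Set (Component α)}

theorem pointed (h : LoopInvariant L 𝒞) (p : UnionState 𝒞) : Pointed L p.1 := by
  obtain ⟨C, hC, hp⟩ := p.2
  exact (h.faithful C hC).pointed _ hp

theorem eq_of_cls_eq (h : LoopInvariant L 𝒞) {p q : UnionState 𝒞} (hc : cls L p.1 = cls L q.1) :
    p = q := by
  obtain ⟨C, hC, hp⟩ := p.2
  obtain ⟨C', hC', hq⟩ := q.2
  obtain rfl := h.disjoint C hC C' hC' _ hp _ hq hc
  exact Subtype.ext ((h.faithful C hC).injective _ hp _ hq hc)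

/-- The canonical state represented by a state of `autOf L 𝒞`. -/
def toCanState (h : LoopInvariant L 𝒞) (p : UnionState 𝒞) : CanState L :=
  CanState.mk L p.1 (h.pointed p)

theorem toCanState_injective (h : LoopInvariant L 𝒞) : Function.Injective h.toCanState :=
  fun _ _ hc => h.eq_of_cls_eq (congrArg Subtype.val hc)

theorem finite_unionState (hL : IsCoBuchi L) (h : LoopInvariant L 𝒞) : Finite (UnionState 𝒞) :=
  have := finite_canState hL
  Finite.of_injective _ h.toCanState_injective

/-- A class on whose representative the automaton is not wrong has a state. -/
theorem exists_state (hL : IsCoBuchi L) (h : LoopInvariant L 𝒞) {u : List α} (hu : u ∈ RSim L)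
    (hx : ∀ x, Sim L (u ++ x) u → LassoMem L u x → LassoMem (autOf L 𝒞).language u x) :
    ∃ q : UnionState 𝒞, Sim L (q.1.1 ++ q.1.2) u := by
  have := h.finite_unionState hL
  by_cases hnt : u ∈ NTSim L
  · obtain ⟨-, x, h1, h2⟩ := hnt
    obtain ⟨q, hq, -⟩ := exists_state_of_lassoMem_autOf h.faithful h1 (hx x h1 h2)
    exact ⟨q, hq⟩
  · refine ⟨⟨(u, []), _, h.trivial_mem u ⟨hu, hnt⟩, ?_⟩, by simpa using Sim.refl u⟩
    rw [states_comp_of_notMem_NTSim ⟨hu, hnt⟩]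
    rfl

/-- If no lasso based in `R` were a counterexample, every `∼`-class would have a state, so every
lasso of `L` would be accepted from any base. By Ramsey the languages would agree. -/
theorem exists_lassoMem_diff [Finite α] (hL : IsCoBuchi L) (h : LoopInvariant L 𝒞)
    (hne : L ≠ (autOf L 𝒞).language) : ∃ u ∈ RSim L, ∃ x,
      LassoMem (L \ (autOf L 𝒞).language) u x ∧ Sim L (u ++ x) u := by
  have hfin := h.finite_unionState hL
  by_contra hcon
  apply hne
  have hR : ∀ u ∈ RSim L, ∀ x, Sim L (u ++ x) u → LassoMem L u x →
      LassoMem (autOf L 𝒞).language u x := by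
    intro u hu x hs hx
    by_contra hx'
    exact hcon ⟨u, hu, x, lassoMem_diff_iff.2 ⟨hx, hx'⟩, hs⟩
  have hstate : ∀ u, ∃ q : UnionState 𝒞, Sim L (q.1.1 ++ q.1.2) u := by
    intro u
    obtain ⟨u₀, hu₀, hs⟩ := exists_RSim_sim (L := L) u
    obtain ⟨q, hq⟩ := h.exists_state hL hu₀ (hR u₀ hu₀)
    exact ⟨q, hq.trans hs⟩
  obtain ⟨Q, _, A, hA⟩ := id hL
  ext w
  obtain ⟨u, x, hprof, h1, h2⟩ := exists_lasso A (autOf L 𝒞) w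
  rw [hA] at h1
  have hs : Sim L (u ++ x) u := hA ▸ sim_of_profile_eq hprof
  rw [h1, h2]
  refine ⟨fun hx => ?_, lassoMem_of_lassoMem_autOf hL h.faithful hs⟩
  obtain ⟨u₀, hu₀, hs₀⟩ := exists_RSim_sim (L := L) u
  have hs₁ : Sim L (u₀ ++ x) u₀ := ((hs₀.append x).trans hs).trans hs₀.symm
  obtain ⟨q, hq, hl⟩ := exists_state_of_lassoMem_autOf h.faithful hs₁
    (hR u₀ hu₀ x hs₁ (hs₀.lassoMem_iff.2 hx))
  exact lassoMem_autOf h.faithful (fun u' _ _ _ => hstate u') hx.ne_nil (hq.trans hs₀) hl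

theorem exists_isIteration [Finite α] (hL : IsCoBuchi L) (h : LoopInvariant L 𝒞)
    (hne : L ≠ (autOf L 𝒞).language) : ∃ u x d v, IsIteration L 𝒞 u x d v := by
  have hfin := h.finite_unionState hL
  obtain ⟨u₀, hu₀, x₀, h1, h2⟩ := h.exists_lassoMem_diff hL hne
  obtain ⟨u, hu⟩ := exists_isSmallest (S := {u' ∈ RSim L | ∃ x',
    LassoMem (L \ (autOf L 𝒞).language) u' x' ∧ Sim L (u' ++ x') u'}) ⟨u₀, hu₀, x₀, h1, h2⟩
  obtain ⟨x, hx⟩ := exists_isSmallest (S := {x' | LassoMem (L \ (autOf L 𝒞).language) u x' ∧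
    Sim L (u ++ x') u}) hu.1.2
  let D : Set ℕ∞ := {n : ℕ∞ | ∃ C ∈ 𝒞, n = C.states.encard} ∪ {1}
  -- Each component embeds into the finite union, so the maximum `d` exists and is finite.
  have hD : D ⊆ Nat.cast '' Set.Iic (max 1 (Nat.card (UnionState 𝒞))) := by
    rintro n (⟨C, hC, rfl⟩ | rfl)
    · let f : C.states → UnionState 𝒞 := fun p => ⟨p.1, C, hC, p.2⟩
      have hf : Function.Injective f := fun p q hpq =>
        Subtype.ext (congrArg (fun r : UnionState 𝒞 => r.1) hpq)
      have hCfin : Finite C.states := Finite.of_injective f hf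
      refine ⟨Nat.card C.states, ?_, ?_⟩
      · exact (Nat.card_le_card_of_injective f hf).trans (le_max_right _ _)
      · rw [Nat.card_coe_set_eq, Set.Finite.cast_ncard_eq (Set.toFinite _)]
    · exact ⟨1, Set.mem_Iic.2 (le_max_left _ _), rfl⟩
  obtain ⟨n, hn, hmax⟩ := Set.exists_max_image D id
    (((Set.finite_Iic _).image _).subset hD) ⟨1, Or.inr rfl⟩
  obtain ⟨d, -, rfl⟩ := hD hn
  have hlive := live_wordPow hx.1.2 (lassoMem_diff_iff.1 hx.1.1).1 d
  obtain ⟨v, hv⟩ := hlive.exists_pointed_right hL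
  exact ⟨u, x, d, v, hne, hu, hx, ⟨hn, hmax⟩, hv⟩

end LoopInvariant

/-- The `1` in the maximum ensures `d ≥ 1`, which keeps the second word non-empty as `≈` requires.
-/
theorem wordPow_append_ne_nil_of_isIteration {𝒞 : Set (Component α)} {u x v : List α} {d : ℕ}
    (hit : IsIteration L 𝒞 u x d v) : wordPow x d ++ v ≠ [] := by
  have hd : (1 : ℕ∞) ≤ d := hit.d_max.2 (Or.inr rfl)
  have hd' : d ≠ 0 := by
    rintro rfl
    simp at hd
  simp [wordPow_ne_nil hit.x_smallest.1.1.ne_nil hd']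

theorem IsIteration.faithful [Finite α] (hL : IsCoBuchi L) {𝒞 : Set (Component α)}
    {u x v : List α} {d : ℕ} (hit : IsIteration L 𝒞 u x d v) :
    Faithful L (comp L (u, wordPow x d ++ v)) :=
  hit.pointed.faithful_comp hL (wordPow_append_ne_nil_of_isIteration hit)

theorem IsIteration.exists_mem_comp [Finite α] {𝒞 : Set (Component α)}
    {u x v : List α} {d : ℕ} (hit : IsIteration L 𝒞 u x d v) :
    ∃ p ∈ (comp L (u, wordPow x d ++ v)).states, cls L p = cls L (u, wordPow x d ++ v) := by
  have := CoBuchiLearning.exists_mem_comp (L := L) (u := u) (v := wordPow x d ++ v) (w := [])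
    (by simpa using hit.pointed.live)
  simpa using this

theorem IsIteration.cls_ne [Finite α] (hL : IsCoBuchi L) {𝒞 : Set (Component α)}
    (h : LoopInvariant L 𝒞) {u x v : List α} {d : ℕ} (hit : IsIteration L 𝒞 u x d v)
    {C : Component α} (hC : C ∈ 𝒞) {q p : List α × List α} (hq : q ∈ C.states)
    (hp : p ∈ (comp L (u, wordPow x d ++ v)).states) : cls L p ≠ cls L q := by
  intro hpq
  have hfin := h.finite_unionState hL
  obtain ⟨p₀, hp₀, hpc⟩ := hit.exists_mem_comp
  obtain ⟨w, hw⟩ := (hit.faithful hL).connected p hp p₀ hp₀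
  -- From `p` the word `w` leads to the class of `(u, x^d v)`, and `y` on to the `∼`-class of `u`,
  -- where `x^d v` is again safe. The old component can imitate this from `q`.
  obtain ⟨y, hy, hly, -⟩ := hit.pointed.exists_return (w := []) (by simpa using hit.pointed.live)
  rw [List.nil_append] at hy hly
  have hqw : cls L (q.1, q.2 ++ w) = cls L (u, wordPow x d ++ v) :=
    (cls_append hpq.symm w).trans (hw.trans hpc)
  have hqwy := cls_append hqw y
  have hlive : Live L q.1 (q.2 ++ w ++ y ++ wordPow x d) := by
    refine live_of_cls_eq (cls_append hqwy _).symm (Live.of_append (x := v) ?_)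
    simpa using hly
  have hfC := h.faithful C hC
  obtain ⟨s, hs, hsc⟩ := hfC.closed q hq (w ++ y) (by simpa using hlive.of_append)
  rw [← List.append_assoc] at hsc
  have hsu : Sim L (s.1 ++ s.2) u := (cls_eq_iff.1 (hsc.trans hqwy)).1.trans hy
  have hd : C.states.encard ≤ d := hit.d_max.2 (Or.inl ⟨C, hC, rfl⟩)
  have hls : Live L s.1 (s.2 ++ wordPow x d) := live_of_cls_eq (cls_append hsc.symm _) hlive
  obtain ⟨r, hr, i, hri, hrl⟩ := hfC.exists_forall_live hd hs hls
  obtain ⟨hxL, hux⟩ := hit.x_smallest.1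
  obtain ⟨hx1, hx2⟩ := lassoMem_diff_iff.1 hxL
  have hru : Sim L (r.1 ++ r.2) u := by
    have h1 := (cls_eq_iff.1 hri).1
    rw [← List.append_assoc] at h1
    exact h1.trans ((hsu.append _).trans (hux.wordPow i))
  refine hx2 (lassoMem_autOf h.faithful (fun u' t ht hut => ?_) hx1.ne_nil
    (q := ⟨r, C, hC, hr⟩) hru hrl)
  -- A proper prefix of `u` is a smaller element of `R`, so by the choice of `u` it has no
  -- counterexample and its class has a state.
  have hu' : u' ∈ RSim L := mem_RSim_of_append (t := t) (hut ▸ hit.u_smallest.1.1)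
  refine h.exists_state hL hu' fun x' hs' hx' => ?_
  by_contra hx''
  have hne : u' ≠ u := by
    rw [hut]
    simpa using ht
  refine shortlex_asymm (hit.u_smallest.2 u'
    ⟨hu', x', lassoMem_diff_iff.2 ⟨hx', hx''⟩, hs'⟩ hne) (List.Shortlex.of_length_lt ?_)
  rw [hut, List.length_append]
  have := List.length_pos_iff.2 ht
  omega

theorem LoopInvariant.insert_comp [Finite α] (hL : IsCoBuchi L) {𝒞 : Set (Component α)}
    (h : LoopInvariant L 𝒞) {u x v : List α} {d : ℕ} (hit : IsIteration L 𝒞 u x d v) :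
    LoopInvariant L (insert (comp L (u, wordPow x d ++ v)) 𝒞) where
  faithful := by
    rintro C (rfl | hC)
    · exact hit.faithful hL
    · exact h.faithful C hC
  disjoint := by
    rintro C (rfl | hC) C' (rfl | hC') p hp q hq hc
    · rfl
    · exact absurd hc (hit.cls_ne hL h hC' hq hp)
    · exact absurd hc.symm (hit.cls_ne hL h hC hp hq)
    · exact h.disjoint C hC C' hC' p hp q hq hc
  trivial_mem := fun u hu => Or.inr (h.trivial_mem u hu)

theorem LoopReaches.loopInvariant [Finite α] (hL : IsCoBuchi L) {n : ℕ} {𝒞 : Set (Component α)}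
    (h : LoopReaches L n 𝒞) : LoopInvariant L 𝒞 := by
  induction h with
  | start => exact loopInvariant_initComponents
  | iterate _ hit ih => exact ih.insert_comp hL hit

/-- Each iteration adds at least the state `p₀`, whose class is new. -/
theorem LoopReaches.le_card_unionState [Finite α] (hL : IsCoBuchi L) {n : ℕ}
    {𝒞 : Set (Component α)} (h : LoopReaches L n 𝒞) : n ≤ Nat.card (UnionState 𝒞) := by
  induction h with
  | start => exact Nat.zero_le _
  | @iterate n 𝒞 u x d v hr hit ih =>
    have hI := hr.loopInvariant hL
    have := hI.finite_unionState hL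
    have := (hI.insert_comp hL hit).finite_unionState hL
    obtain ⟨p₀, hp₀, -⟩ := hit.exists_mem_comp
    let f : Option (UnionState 𝒞) → UnionState (insert (comp L (u, wordPow x d ++ v)) 𝒞)
      | none => ⟨p₀, _, Or.inl rfl, hp₀⟩
      | some p => ⟨p.1, p.2.imp fun _ h => ⟨Or.inr h.1, h.2⟩⟩
    have hne : ∀ p : UnionState 𝒞, p₀ ≠ p.1 := by
      rintro ⟨p, C, hC, hp⟩ rfl
      exact hit.cls_ne hL hI hC hp hp₀ rfl
    have hf : Function.Injective f := by
      rintro (_ | p) (_ | q) hpq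
      · rfl
      · exact absurd (congrArg Subtype.val hpq) (hne q)
      · exact absurd (congrArg Subtype.val hpq).symm (hne p)
      · have hpq' := congrArg Subtype.val hpq
        exact congrArg some (Subtype.ext hpq')
    have := Nat.card_le_card_of_injective f hf
    rw [Finite.card_option] at this
    omega

theorem LoopReaches.le_card [Finite α] (hL : IsCoBuchi L) {n : ℕ} {𝒞 : Set (Component α)}
    (h : LoopReaches L n 𝒞) : n ≤ Nat.card (CanState L) :=
  have := finite_canState hL
  (h.le_card_unionState hL).trans
    (Nat.card_le_card_of_injective _ (h.loopInvariant hL).toCanState_injective)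

theorem exists_returns [Finite α] (hL : IsCoBuchi L) : ∃ n 𝒞, Returns L n 𝒞 := by
  by_contra hcon
  have key : ∀ n, ∃ 𝒞, LoopReaches L n 𝒞 := by
    intro n
    induction n with
    | zero => exact ⟨_, LoopReaches.start⟩
    | succ n ih =>
      obtain ⟨𝒞, h𝒞⟩ := ih
      obtain ⟨u, x, d, v, hit⟩ := (h𝒞.loopInvariant hL).exists_isIteration hL
        fun h => hcon ⟨n, 𝒞, h𝒞, h⟩
      exact ⟨_, h𝒞.iterate hit⟩
  obtain ⟨𝒞, h𝒞⟩ := key (Nat.card (CanState L) + 1)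
  have := h𝒞.le_card hL
  omega

/-- A non-empty live extension of `(u, v)` closes to a loop whose lasso is in `L`, hence accepted.
Otherwise `v` is empty and `u` has a trivial class, which is an initial component. -/
theorem LoopInvariant.toCanState_surjective [Finite α] (hL : IsCoBuchi L)
    {𝒞 : Set (Component α)} (h : LoopInvariant L 𝒞) (hlang : L = (autOf L 𝒞).language) :
    Function.Surjective h.toCanState := by
  have hfin := h.finite_unionState hL
  suffices H : ∀ u v, Pointed L (u, v) → ∃ p : UnionState 𝒞, cls L p.1 = cls L (u, v) by
    rintro ⟨c, ⟨u, v⟩, hp, rfl⟩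
    obtain ⟨p, hp'⟩ := H u v hp
    exact ⟨p, Subtype.ext hp'⟩
  intro u v hp
  by_cases hex : ∃ w, v ++ w ≠ [] ∧ Live L u (v ++ w)
  · obtain ⟨w, hne, hl⟩ := hex
    obtain ⟨y, hs, hly, -⟩ := hp.exists_return hl
    have hne' : v ++ (w ++ y) ≠ [] := by
      rw [← List.append_assoc]
      exact List.append_ne_nil_of_left_ne_nil hne y
    obtain ⟨hx, hmem⟩ := (hp.lassoMem_iff hL hne' hs).2 hly
    obtain ⟨q, hq, hql⟩ := exists_state_of_lassoMem_autOf h.faithful hs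
      (⟨hx, hlang.subset hmem⟩ : LassoMem (autOf L 𝒞).language u (v ++ (w ++ y)))
    have hlv : Live L q.1.1 (q.1.2 ++ v) := by
      refine Live.of_append (x := w ++ y) ?_
      simpa using hql 1
    obtain ⟨C, hC, hqC⟩ := q.2
    obtain ⟨p, hpC, hpc⟩ := (h.faithful C hC).closed _ hqC v hlv
    -- Since `q ∼ u` and reading `v` from `q` is live, pointedness of `(u, v)` identifies the class
    -- reached.
    exact ⟨⟨p, C, hC, hpC⟩, hpc.trans (hp.cls_eq hq hlv)⟩
  · push Not at hex
    have hnil : ∀ w, Live L u (v ++ w) → v ++ w = [] := fun w hw => by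
      by_contra hne
      exact hw (hex w hne)
    obtain rfl : v = [] := by
      have := hnil [] (by simpa using hp.live)
      simpa using this
    obtain ⟨u₀, hu₀, hs⟩ := exists_RSim_sim (L := L) u
    have hnt : u₀ ∉ NTSim L := by
      rintro ⟨-, x, h1, h2⟩
      have h3 := (live_wordPow h1 h2 1).congr hs
      rw [wordPow_one] at h3
      exact h2.ne_nil (hnil x h3)
    refine ⟨⟨(u₀, []), _, h.trivial_mem u₀ ⟨hu₀, hnt⟩, ?_⟩,
      cls_eq_iff.2 ⟨by simpa using hs, safeExt_congr hs []⟩⟩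
    rw [states_comp_of_notMem_NTSim ⟨hu₀, hnt⟩]
    rfl

/-- Disjointness is essential for the converse: the successor found in the component of `p` must be
`q` itself. -/
theorem LoopInvariant.trans_two_iff {𝒞 : Set (Component α)} (h : LoopInvariant L 𝒞)
    {p q : UnionState 𝒞} {a : α} : (autOf L 𝒞).trans p a Rank.two q ↔
      cls L (p.1.1, p.1.2 ++ [a]) = cls L q.1 := by
  constructor
  · rintro ⟨C, hC, hp, hq, ht⟩
    exact ((h.faithful C hC).trans_iff _ hp _ _ hq).1 ht
  · intro hc
    obtain ⟨C, hC, hp⟩ := p.2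
    obtain ⟨r, hr, hrc⟩ := (h.faithful C hC).closed _ hp [a]
      (live_of_cls_eq hc.symm (h.pointed q).1)
    have hrq : (⟨r, C, hC, hr⟩ : UnionState 𝒞) = q := h.eq_of_cls_eq (hrc.trans hc)
    subst hrq
    exact ⟨C, hC, hp, hr, ((h.faithful C hC).trans_iff _ hp _ _ hr).2 hc⟩

/-- The returned automaton is isomorphic to the canonical one. -/
noncomputable def LoopInvariant.iso [Finite α] (hL : IsCoBuchi L) {𝒞 : Set (Component α)}
    (h : LoopInvariant L 𝒞) (hlang : L = (autOf L 𝒞).language) :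
    CoBuchiAut.Iso (autOf L 𝒞) (canonical L) where
  toEquiv := Equiv.ofBijective h.toCanState
    ⟨h.toCanState_injective, h.toCanState_surjective hL hlang⟩
  map_init p := canonical_init_iff (h.pointed p)
  map_trans p a i q := by
    cases i with
    | one => exact canonical_one_iff (h.pointed p) (h.pointed q)
    | two => exact (canonical_two_iff (h.pointed p) (h.pointed q)).trans h.trans_two_iff.symm

end Learner

end CoBuchiLearning

theorem theorem4p7 {α : Type*} [LinearOrder α] [Finite α] [Nonempty α]
    (L : Set (Stream' α)) (hL : IsCoBuchi L) :
    -- the canonical automaton and the set of class representatives are finite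
    Finite (CanState L) ∧ (RSim L).Finite ∧
    -- no execution makes more iterations than the canonical automaton has states
    (∀ n 𝒞, LoopReaches L n 𝒞 → n ≤ Nat.card (CanState L)) ∧
    -- no execution gets stuck: when the loop is not left, every object searched for exists
    (∀ n 𝒞, LoopReaches L n 𝒞 → L ≠ (autOf L 𝒞).language →
      ∃ u x d v, IsIteration L 𝒞 u x d v) ∧
    -- each iteration adds a safe SCC of the canonical automaton that was not there before
    (∀ n 𝒞, LoopReaches L n 𝒞 → ∀ u x d v, ∀ h : IsIteration L 𝒞 u x d v,
      IsSafeSCCOf L (comp L (u, wordPow x d ++ v)) (CanState.mk L _ h.pointed) ∧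
      ∀ C ∈ 𝒞, ∀ q ∈ C.states, ∀ p ∈ (comp L (u, wordPow x d ++ v)).states,
        cls L p ≠ cls L q) ∧
    -- the returned automaton is the canonical one, each state being a representative of its class
    (∃ n 𝒞, Returns L n 𝒞) ∧
    (∀ n 𝒞, Returns L n 𝒞 →
      ∃ e : CoBuchiAut.Iso (autOf L 𝒞) (canonical L), ∀ p, (e.toEquiv p).1 = cls L p.1) := by
  refine ⟨finite_canState hL, finite_RSim hL, fun n 𝒞 h => h.le_card hL,
    fun n 𝒞 h hne => (h.loopInvariant hL).exists_isIteration hL hne,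
    fun n 𝒞 h u x d v hit => ⟨?_, fun C hC q hq p hp => ?_⟩, exists_returns hL,
    fun n 𝒞 h => ⟨(h.1.loopInvariant hL).iso hL h.2, fun p => rfl⟩⟩
  · obtain ⟨p, hp, hc⟩ := hit.exists_mem_comp
    exact (hit.faithful hL).isSafeSCCOf hp hc.symm
  · exact hit.cls_ne hL (h.loopInvariant hL) hC hq hp
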